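/- **Setting.** There are $K$ arms, a measurable context space $\mathcal X$, and $N$ stochastic experts $\pi_1,\dots,\pi_N$, each a conditional distribution $\pi_i(v\mid x)$ of an arm given a context. In each time step nature draws a context and rewards $(x,r_1,\dots,r_K)$, $r_v\in[0,1]$, from a fixed probability distribution; if expert $k$ is followed, an arm $v$ is drawn from $\pi_k(\cdot\mid x)$ and $y=r_v$ is observed. Let $p_k$ be the resulting law of $(X,V,Y)$, $\mu_k=\mathbb E_{p_k}[Y]$, $\mu^*=\max_k\mu_k$, $\Delta_k=\mu^*-\mu_k$, and let $0=\Delta_{(1)}\le\dots\le\Delta_{(N)}$ be the gaps in nondecreasing order. Let $\sigma_{ij}^2=1+\mathbb E_{p_j}\big[\big(\tfrac{\pi_i(V\mid X)}{\pi_j(V\mid X)}\big)^2-1\big]$, that is, one plus the conditional chi-square divergence of $\pi_i$ from $\pi_j$ (infinite if $\pi_i(\cdot\mid x)\not\ll\pi_j(\cdot\mid x)$ with positive probability), and $\sigma=\max_{i,j}\sigma_{ij}$. **Algorithm (D-UCB with the importance-sampling median-of-means estimator).** Put $\delta(t)=1/t^2$ and $l(t)=\lfloor 8\log(1/\delta(t))\rfloor$.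 At time $t$ the samples of the times $1,\dots,t$ are divided into $l(t)$ groups by a rule that places the samples one after the other, looking only at the experts followed so far, such that every group contains at least $\lfloor n_i(t)/l(t)\rfloor$ of the $n_i(t)$ samples of each expert $i$ and at least $\lfloor t/(2l(t))\rfloor$ samples in all. Let $\mathcal T^{(r)}_j$ be the set of times of the samples from expert $j$ in group $r$, $n_j(r,t)=|\mathcal T^{(r)}_j|$, $n(r,t)=\sum_j n_j(r,t)$, $W_k(r,t)=\sum_j n_j(r,t)/\sigma_{kj}$, $W_k(t)=\min_r W_k(r,t)/n(r,t)$, $$\hat\mu_k^{(r)}(t)=\frac1{W_k(r,t)}\sum_{j=1}^N\sum_{s\in\mathcal T^{(r)}_j}\frac1{\sigma_{kj}}\,y_s\,\frac{\pi_k(v_s\mid x_s)}{\pi_j(v_s\mid x_s)},\qquad U_k(t)=\operatorname{median}_{r}\hat\mu^{(r)}_k(t)+\frac1{W_k(t)}\sqrt{\frac{64\log(1/\delta(t))}{t}}.$$ The first expert is chosen at random (with any distribution); at time $t+1\ge2$ an expert $k(t+1)\in\arg\max_kU_k(t)$ is followed, with ties broken arbitrarily. If $U(t)$ is undefined because $l(t)=0$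 or some group is empty (which can happen only for $t$ below an absolute constant), the next expert is arbitrary. The (expected) regret is $R(T)=\mathbb E\sum_{t=1}^T(\mu^*-\mu_{k(t)})$. **Theorem.** There is a universal constant $C_2>0$ such that, for every such bandit with all $\sigma_{ij}$ finite, every such division rule and every $T\ge1$, $$R(T)\le\frac{C_2\sigma^2\log T}{\Delta_{(N)}}+\sum_{k=2}^{N-1}\frac{C_2\sigma^2\log T}{\Delta_{(k)}}\Big(1-\frac{\Delta_{(k)}^2}{\Delta_{(k+1)}^2}\Big)+\frac{\pi^2}{3}\sum_{i=2}^N\Delta_{(i)},$$ where any of the first $N-1$ terms whose denominator $\Delta_{(k)}$ (or $\Delta_{(N)}$) is $0$ is read as $0$. -/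

import Mathlib

open MeasureTheory ProbabilityTheory

noncomputable section

/-- A contextual bandit with `K` arms and `N` stochastic experts on the context space `𝒳`.
`nature` is the joint law of the context and of the rewards `r_1, …, r_K ∈ [0,1]` of the arms in
one time step; `expert i` is the conditional distribution `π_i(v | x)` of the arm given the
context. -/
structure ExpertBandit (𝒳 : Type*) [MeasurableSpace 𝒳] (K N : ℕ) where
  nature : Measure (𝒳 × (Fin K → ℝ))
  isProbabilityMeasure : IsProbabilityMeasure nature
  reward_mem : ∀ᵐ z ∂nature, ∀ v, z.2 v ∈ Set.Icc (0 : ℝ) 1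
  expert : Fin N → Kernel 𝒳 (Fin K)
  isMarkovKernel : ∀ i, IsMarkovKernel (expert i)

namespace ExpertBandit

variable {𝒳 : Type*} [MeasurableSpace 𝒳] {K N : ℕ} (B : ExpertBandit 𝒳 K N)

/-- `π_i(v | x)`. -/
def prob (i : Fin N) (x : 𝒳) (v : Fin K) : ℝ := (B.expert i x).real {v}

/-- The importance ratio `π_i(v | x) / π_j(v | x)`. -/
def ratio (i j : Fin N) (x : 𝒳) (v : Fin K) : ℝ := B.prob i x v / B.prob j x v

/-- `p_k`, the joint law of (context, arm, observed reward) in a time step in which expert `k` is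
followed: the context and the rewards are drawn from `nature`, the arm from `π_k(· | x)`, and the
reward of the drawn arm is observed. -/
def law (k : Fin N) : Measure (𝒳 × Fin K × ℝ) :=
  (B.nature ⊗ₘ Kernel.prodMkRight (Fin K → ℝ) (B.expert k)).map
    fun z => (z.1.1, z.2, z.1.2 z.2)

/-- `μ_k`, the mean reward of expert `k`. -/
def mean (k : Fin N) : ℝ := ∫ z, z.2.2 ∂B.law k

/-- `μ* = max_k μ_k`. -/
def bestMean : ℝ := ⨆ k, B.mean k

/-- `Δ_k = μ* - μ_k`. -/
def gap (k : Fin N) : ℝ := B.bestMean - B.mean k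

/-- `Δ_(k)` for `k = 1, …, N`: the gaps in nondecreasing order (and `0` for other `k`). -/
def sortedGap (k : ℕ) : ℝ :=
  if h : 1 ≤ k ∧ k ≤ N then B.gap (Tuple.sort B.gap ⟨k - 1, by omega⟩) else 0

/-- The conditional `f`-divergence `D_f(π_i ‖ π_j) = E_{p_j}[f(π_i(V|X) / π_j(V|X))]`. -/
def condFDiv (f : ℝ → ℝ) (i j : Fin N) : ℝ := ∫ z, f (B.ratio i j z.1 z.2.1) ∂B.law j

/-- `σ_ij`, where `σ_ij² = 1 + D_f(π_i ‖ π_j)` with `f(x) = x² - 1`. -/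
def sigma (i j : Fin N) : ℝ := √(1 + B.condFDiv (fun x => x ^ 2 - 1) i j)

/-- All pairwise chi-square divergences are finite: as usual this means that `π_i(· | x)` is
absolutely continuous with respect to `π_j(· | x)` for almost every context `x`, and that the
integral that defines the divergence converges. -/
def ChiSquareFinite : Prop :=
  ∀ i j, (∀ᵐ z ∂B.nature, ∀ v, B.prob j z.1 v = 0 → B.prob i z.1 v = 0) ∧
    Integrable (fun z => B.ratio i j z.1 z.2.1 ^ 2 - 1) (B.law j)

/-- `σ = max_{i,j} σ_ij`. -/
def sigmaMax : ℝ := ⨆ p : Fin N × Fin N, B.sigma p.1 p.2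

end ExpertBandit

/-- `δ(t) = 1 / t²`. -/
def delta (t : ℕ) : ℝ := 1 / (t : ℝ) ^ 2

/-- The number of groups `l(t) = ⌊8 log (1 / δ(t))⌋`. -/
def numGroups (t : ℕ) : ℕ := ⌊8 * Real.log (1 / delta t)⌋₊

/-- A rule that divides, for each `t`, the samples of the times `1, …, t` into the groups
`0, …, l(t) - 1`. If `h s` is the expert followed at time `s`, the sample of time `s` goes to
group `assign t h s`.

The samples are placed one after the other, by looking only at the experts followed so far. Every
group receives at least `⌊n_i(t) / l(t)⌋` samples of every expert `i`, so that the fractions of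
the experts are preserved, and no group falls short of half of its share `t / l(t)` of all
samples (rounded down). -/
structure Division (N : ℕ) where
  assign : ℕ → (ℕ → Fin N) → ℕ → ℕ
  assign_congr : ∀ (t : ℕ) (h h' : ℕ → Fin N) (s : ℕ),
    (∀ u ∈ Finset.Icc 1 s, h u = h' u) → assign t h s = assign t h' s
  assign_lt : ∀ (t : ℕ) (h : ℕ → Fin N), 1 ≤ numGroups t →
    ∀ s ∈ Finset.Icc 1 t, assign t h s < numGroups t
  expert_share : ∀ (t : ℕ) (h : ℕ → Fin N), ∀ r < numGroups t, ∀ i : Fin N,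
    ((Finset.Icc 1 t).filter fun s => h s = i).card / numGroups t ≤
      ((Finset.Icc 1 t).filter fun s => h s = i ∧ assign t h s = r).card
  group_size : ∀ (t : ℕ) (h : ℕ → Fin N), ∀ r < numGroups t,
    t / (2 * numGroups t) ≤ ((Finset.Icc 1 t).filter fun s => assign t h s = r).card

namespace Division

variable {N : ℕ} (D : Division N)

/-- `𝒯_j^(r)`: the times up to `t` whose sample comes from expert `j` and lies in group `r`. -/
def samples (t : ℕ) (h : ℕ → Fin N) (r : ℕ) (j : Fin N) : Finset ℕ :=
  (Finset.Icc 1 t).filter fun s => h s = j ∧ D.assign t h s = r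

/-- `n(r,t) = ∑_i n_i(r,t)`, the size of group `r`. -/
def size (t : ℕ) (h : ℕ → Fin N) (r : ℕ) : ℕ := ∑ i, (D.samples t h r i).card

end Division

/-- The median of finitely many reals: the mean of the two middle entries of the sorted list, which
coincide if the number of entries is odd. -/
def median {n : ℕ} (f : Fin n → ℝ) : ℝ :=
  if h : 0 < n then
    (f (Tuple.sort f ⟨(n - 1) / 2, by omega⟩) + f (Tuple.sort f ⟨n / 2, by omega⟩)) / 2
  else 0

namespace ExpertBandit

variable {𝒳 : Type*} [MeasurableSpace 𝒳] {K N : ℕ} (B : ExpertBandit 𝒳 K N) (D : Division N)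

/-- `W_k(r,t) = ∑_i n_i(r,t) / σ_ki`. -/
def groupWeight (t : ℕ) (h : ℕ → Fin N) (k : Fin N) (r : ℕ) : ℝ :=
  ∑ i, ((D.samples t h r i).card : ℝ) / B.sigma k i

/-- The importance sampling estimate of the mean of expert `k` from group `r`; `z s` is the
observation (context, arm, reward) of time `s`. -/
def groupMean (t : ℕ) (h : ℕ → Fin N) (z : ℕ → 𝒳 × Fin K × ℝ) (k : Fin N) (r : ℕ) : ℝ :=
  1 / B.groupWeight D t h k r *
    ∑ j, ∑ s ∈ D.samples t h r j,
      1 / B.sigma k j * (z s).2.2 * B.ratio k j (z s).1 (z s).2.1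

/-- The median of means estimator of the mean of expert `k` at time `t`. -/
def momEstimate (t : ℕ) (h : ℕ → Fin N) (z : ℕ → 𝒳 × Fin K × ℝ) (k : Fin N) : ℝ :=
  median fun r : Fin (numGroups t) => B.groupMean D t h z k r

/-- `W_k(t) = min_r W_k(r,t) / n(r,t)`. -/
def minWeight (t : ℕ) (h : ℕ → Fin N) (k : Fin N) : ℝ :=
  ⨅ r : Fin (numGroups t), B.groupWeight D t h k r / (D.size t h r : ℝ)

/-- The confidence width `s_k(t) = (1 / W_k(t)) √(64 log (1 / δ(t)) / t)`. -/
def width (t : ℕ) (h : ℕ → Fin N) (k : Fin N) : ℝ :=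
  1 / B.minWeight D t h k * √(64 * Real.log (1 / delta t) / t)

/-- The upper confidence index `U_k(t)`. -/
def ucb (t : ℕ) (h : ℕ → Fin N) (z : ℕ → 𝒳 × Fin K × ℝ) (k : Fin N) : ℝ :=
  B.momEstimate D t h z k + B.width D t h k

end ExpertBandit

/-- The information available before time `t`: experts and observations of the times
`1, …, t - 1`. -/
@[reducible]
def pastInfo {Ω 𝒳 : Type*} [MeasurableSpace 𝒳] {K N : ℕ} (k : ℕ → Ω → Fin N)
    (Z : ℕ → Ω → 𝒳 × Fin K × ℝ) (t : ℕ) : MeasurableSpace Ω :=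
  ⨆ s ∈ Finset.Ico 1 t,
    MeasurableSpace.comap (k s) inferInstance ⊔ MeasurableSpace.comap (Z s) inferInstance

/-- `k` (expert followed) and `Z` (context, arm, reward), at the times `1, 2, …`, are a run of
D-UCB with the median of means estimator on the bandit `B`.

* `observe`: given the past and the choice `k t = j`, the observation of time `t` has law `p_j`.
* `choose`: the expert of time `t + 1` maximizes the index `U(t)`; ties may be broken in any way.

The first expert may be drawn in any way. The index `U(t)` only makes sense if there is at least
one group and no group is empty; while this fails (only for `t` below an absolute constant, such as
`t = 1`, where `l(t) = 0`), any expert may be followed next. -/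
structure IsDUCBRun {Ω 𝒳 : Type*} [MeasurableSpace Ω] [MeasurableSpace 𝒳] {K N : ℕ}
    (B : ExpertBandit 𝒳 K N) (D : Division N) (P : Measure Ω)
    (k : ℕ → Ω → Fin N) (Z : ℕ → Ω → 𝒳 × Fin K × ℝ) : Prop where
  measurable_expert : ∀ t, Measurable (k t)
  measurable_obs : ∀ t, Measurable (Z t)
  observe : ∀ t, 1 ≤ t → ∀ A, MeasurableSet[pastInfo k Z t] A → ∀ (j : Fin N) (S : Set _),
    MeasurableSet S → P (A ∩ k t ⁻¹' {j} ∩ Z t ⁻¹' S) = P (A ∩ k t ⁻¹' {j}) * B.law j S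
  choose : ∀ t, 1 ≤ t → ∀ᵐ ω ∂P,
    1 ≤ numGroups t → (∀ r < numGroups t, 1 ≤ D.size t (fun s => k s ω) r) →
    ∀ j, B.ucb D t (fun s => k s ω) (fun s => Z s ω) j ≤
      B.ucb D t (fun s => k s ω) (fun s => Z s ω) (k (t + 1) ω)

/-- The (expected) regret `R(T) = E ∑_{t=1}^T (μ* - μ_{k(t)})`. -/
def regret {Ω 𝒳 : Type*} [MeasurableSpace Ω] [MeasurableSpace 𝒳] {K N : ℕ}
    (B : ExpertBandit 𝒳 K N) (P : Measure Ω) (k : ℕ → Ω → Fin N) (T : ℕ) : ℝ :=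
  ∫ ω, ∑ t ∈ Finset.Icc 1 T, (B.bestMean - B.mean (k t ω)) ∂P

end

/-! An observation made under expert `j`, turned into a `score` for expert `i`, has mean 0, variance
at most 1 and lower bound -1, but possibly a heavy upper tail. Expert choices depend on the whole
past, so the groups of the median of means are not independent. Independence is replaced by a
product supermartingale: if a potential `g` of (group size, sum of scores) is a supermartingale for
every expert, then so is the product of `1 + g` over the groups, since a sample changes only one
factor (`lintegral_prod_group_le`). Markov's inequality then makes it exponentially unlikely in the
number of groups that half of them have `g ≥ 2` (`measure_half_groups_le`).

The best expert must not be underestimated by more than one width; there the scores are bounded on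
the relevant side and an exponential potential works. For overestimation only second moments exist;
a quadratic potential works because three widths are allowed. Hence an expert with gap at least four
widths is followed after time `t` with probability at most 4/t² (`measure_expert_le`).

At time `s` the experts not yet excluded have gap below a threshold of order `σ √(log s / s)`.
Cutting each gap into layers `Δ_(i) - Δ_(i-1)`, layer `i` is paid for only while `s` is below a
multiple of `σ² log T / Δ_(i)²`; summation by parts (`sum_layers_eq`) yields the stated form. The
tails 4/s² and the first step are covered by the π²/3 term, the bounded initial phase by the
constant. -/

lemma integral_sub_const_sq {Ω : Type*} [MeasurableSpace Ω] {μ : Measure Ω}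
    [IsProbabilityMeasure μ] {f : Ω → ℝ} (hf : MemLp f 2 μ) (c : ℝ) :
    ∫ ω, (f ω - c) ^ 2 ∂μ = ∫ ω, f ω ^ 2 ∂μ - 2 * c * ∫ ω, f ω ∂μ + c ^ 2 := by
  have hi := (hf.integrable one_le_two).const_mul (2 * c)
  have h : ∀ ω, (f ω - c) ^ 2 = f ω ^ 2 - 2 * c * f ω + c ^ 2 := fun ω => by ring
  have hs : Integrable (fun ω => f ω ^ 2 - 2 * c * f ω) μ := hf.integrable_sq.sub hi
  simp_rw [h]
  rw [integral_add hs (integrable_const _),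
    integral_sub hf.integrable_sq hi, integral_const_mul]
  simp

/-! ### Moments of the importance ratio and of the score -/

namespace ExpertBandit

variable {𝒳 : Type*} [MeasurableSpace 𝒳] {K N : ℕ} (B : ExpertBandit 𝒳 K N)

lemma measurable_observation :
    Measurable fun z : (𝒳 × (Fin K → ℝ)) × Fin K => (z.1.1, z.2, z.1.2 z.2) := by
  refine (measurable_fst.comp measurable_fst).prodMk (measurable_snd.prodMk ?_)
  exact measurable_from_prod_countable_left fun v =>
    (measurable_pi_apply v).comp measurable_snd

lemma isProbabilityMeasure_law (j : Fin N) : IsProbabilityMeasure (B.law j) := by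
  have := B.isProbabilityMeasure
  have := B.isMarkovKernel j
  exact Measure.isProbabilityMeasure_map measurable_observation.aemeasurable

lemma lintegral_law (j : Fin N) {f : 𝒳 × Fin K × ℝ → ENNReal} (hf : Measurable f) :
    ∫⁻ z, f z ∂B.law j =
      ∫⁻ w, ∑ v, f (w.1, v, w.2 v) * ENNReal.ofReal (B.prob j w.1 v) ∂B.nature := by
  have := B.isProbabilityMeasure
  have := B.isMarkovKernel j
  rw [law, lintegral_map hf measurable_observation]
  refine (Measure.lintegral_compProd (hf.comp measurable_observation)).trans ?_
  simp [lintegral_fintype, prob]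

lemma prob_nonneg (j : Fin N) (x : 𝒳) (v : Fin K) : 0 ≤ B.prob j x v := measureReal_nonneg

lemma ratio_nonneg (i j : Fin N) (x : 𝒳) (v : Fin K) : 0 ≤ B.ratio i j x v :=
  div_nonneg (B.prob_nonneg i x v) (B.prob_nonneg j x v)

lemma measurable_prob (j : Fin N) (v : Fin K) : Measurable fun x => B.prob j x v :=
  ((B.expert j).measurable_coe (measurableSet_singleton v)).ennreal_toReal

lemma measurable_ratio (i j : Fin N) :
    Measurable fun z : 𝒳 × Fin K × ℝ => B.ratio i j z.1 z.2.1 := by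
  have : Measurable fun p : 𝒳 × Fin K => B.ratio i j p.1 p.2 :=
    measurable_from_prod_countable_left fun v =>
      (B.measurable_prob i v).div (B.measurable_prob j v)
  exact this.comp (measurable_fst.prodMk (measurable_fst.comp measurable_snd))

lemma ae_law_reward_mem (j : Fin N) : ∀ᵐ z ∂B.law j, z.2.2 ∈ Set.Icc (0 : ℝ) 1 := by
  have := B.isProbabilityMeasure
  have := B.isMarkovKernel j
  have hm : MeasurableSet {z : 𝒳 × Fin K × ℝ | z.2.2 ∈ Set.Icc (0 : ℝ) 1} :=
    (measurable_snd.comp measurable_snd) measurableSet_Icc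
  rw [law, ae_map_iff measurable_observation.aemeasurable hm]
  refine Measure.ae_compProd_of_ae_ae (measurable_observation hm) ?_
  filter_upwards [B.reward_mem] with w hw
  exact Filter.Eventually.of_forall fun v => hw v

/-- Under absolute continuity, the importance ratio is the density of one law in another. -/
lemma law_eq_withDensity (hB : B.ChiSquareFinite) (i j : Fin N) :
    B.law i = (B.law j).withDensity fun z => ENNReal.ofReal (B.ratio i j z.1 z.2.1) := by
  refine Measure.ext_of_lintegral _ fun f hf => ?_
  have hr := (B.measurable_ratio i j).ennreal_ofReal
  rw [lintegral_withDensity_eq_lintegral_mul _ hr hf, B.lintegral_law i hf,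
    B.lintegral_law j (hr.mul hf)]
  refine lintegral_congr_ae ?_
  filter_upwards [(hB i j).1] with w hw
  refine Finset.sum_congr rfl fun v _ => ?_
  have : B.prob i w.1 v = B.ratio i j w.1 v * B.prob j w.1 v := by
    -- Where the denominator vanishes the ratio is 0 by convention, and absolute continuity makes
    -- the numerator vanish as well.
    by_cases h : B.prob j w.1 v = 0
    · simp [h, hw v h]
    · rw [ratio, div_mul_cancel₀ _ h]
  rw [this, ENNReal.ofReal_mul (B.ratio_nonneg _ _ _ _)]
  simp only [Pi.mul_apply]
  ring

lemma integral_ratio_mul (hB : B.ChiSquareFinite) (i j : Fin N) (f : 𝒳 × Fin K × ℝ → ℝ) :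
    ∫ z, B.ratio i j z.1 z.2.1 * f z ∂B.law j = ∫ z, f z ∂B.law i := by
  rw [B.law_eq_withDensity hB i j, integral_withDensity_eq_integral_toReal_smul
    (B.measurable_ratio i j).ennreal_ofReal (by simp)]
  simp [ENNReal.toReal_ofReal (B.ratio_nonneg _ _ _ _)]

lemma memLp_ratio (hB : B.ChiSquareFinite) (i j : Fin N) :
    MemLp (fun z => B.ratio i j z.1 z.2.1) 2 (B.law j) := by
  have := B.isProbabilityMeasure_law j
  rw [memLp_two_iff_integrable_sq (B.measurable_ratio i j).aestronglyMeasurable]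
  refine ((hB i j).2.add (integrable_const (1 : ℝ))).congr (Filter.Eventually.of_forall ?_)
  simp

lemma one_add_condFDiv (hB : B.ChiSquareFinite) (i j : Fin N) :
    1 + B.condFDiv (fun x => x ^ 2 - 1) i j = ∫ z, B.ratio i j z.1 z.2.1 ^ 2 ∂B.law j := by
  have := B.isProbabilityMeasure_law j
  rw [condFDiv, integral_sub (B.memLp_ratio hB i j).integrable_sq (integrable_const _)]
  simp

/-- The ratio has mean 1 under `p_j`, and its variance is nonnegative. -/
lemma one_le_integral_ratio_sq (hB : B.ChiSquareFinite) (i j : Fin N) :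
    1 ≤ ∫ z, B.ratio i j z.1 z.2.1 ^ 2 ∂B.law j := by
  have := B.isProbabilityMeasure_law j
  have := B.isProbabilityMeasure_law i
  have h1 : ∫ z, B.ratio i j z.1 z.2.1 ∂B.law j = 1 := by
    simpa using B.integral_ratio_mul hB i j fun _ => 1
  have hL := B.memLp_ratio hB i j
  have h : 0 ≤ ∫ z, (B.ratio i j z.1 z.2.1 - 1) ^ 2 ∂B.law j :=
    integral_nonneg fun z => sq_nonneg _
  rw [integral_sub_const_sq hL, h1] at h
  linarith

lemma sigma_sq (hB : B.ChiSquareFinite) (i j : Fin N) :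
    B.sigma i j ^ 2 = ∫ z, B.ratio i j z.1 z.2.1 ^ 2 ∂B.law j := by
  rw [sigma, B.one_add_condFDiv hB, Real.sq_sqrt]
  linarith [B.one_le_integral_ratio_sq hB i j]

lemma one_le_sigma (hB : B.ChiSquareFinite) (i j : Fin N) : 1 ≤ B.sigma i j := by
  rw [sigma, Real.one_le_sqrt, B.one_add_condFDiv hB]
  exact B.one_le_integral_ratio_sq hB i j

lemma sigma_pos (hB : B.ChiSquareFinite) (i j : Fin N) : 0 < B.sigma i j :=
  zero_lt_one.trans_le (B.one_le_sigma hB i j)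

lemma sigma_le_sigmaMax (i j : Fin N) : B.sigma i j ≤ B.sigmaMax :=
  le_ciSup (f := fun p : Fin N × Fin N => B.sigma p.1 p.2) (Set.finite_range _).bddAbove (i, j)

lemma mean_mem (i : Fin N) : B.mean i ∈ Set.Icc (0 : ℝ) 1 := by
  have := B.isProbabilityMeasure_law i
  have h := B.ae_law_reward_mem i
  refine ⟨integral_nonneg_of_ae (h.mono fun z hz => hz.1), ?_⟩
  have hi : Integrable (fun z : 𝒳 × Fin K × ℝ => z.2.2) (B.law i) :=
    Integrable.of_mem_Icc 0 1 (measurable_snd.comp measurable_snd).aemeasurable h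
  have := integral_mono_ae hi (integrable_const (1 : ℝ)) (h.mono fun z hz => hz.2)
  simpa [mean] using this

/-- The centred and normalized importance sampling score: an observation made under expert `j`
is used to estimate the mean of expert `i`. -/
noncomputable def score (i j : Fin N) (z : 𝒳 × Fin K × ℝ) : ℝ :=
  (z.2.2 * B.ratio i j z.1 z.2.1 - B.mean i) / B.sigma i j

lemma measurable_score (i j : Fin N) : Measurable (B.score i j) :=
  (((measurable_snd.comp measurable_snd).mul (B.measurable_ratio i j)).sub_const _).div_const _

lemma memLp_reward_mul_ratio (hB : B.ChiSquareFinite) (i j : Fin N) :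
    MemLp (fun z => z.2.2 * B.ratio i j z.1 z.2.1) 2 (B.law j) := by
  refine (B.memLp_ratio hB i j).mono
    ((measurable_snd.comp measurable_snd).mul (B.measurable_ratio i j)).aestronglyMeasurable ?_
  filter_upwards [B.ae_law_reward_mem j] with z hz
  rw [norm_mul, Real.norm_of_nonneg hz.1]
  exact mul_le_of_le_one_left (norm_nonneg _) hz.2

lemma memLp_score (hB : B.ChiSquareFinite) (i j : Fin N) : MemLp (B.score i j) 2 (B.law j) := by
  have := B.isProbabilityMeasure_law j
  have h := ((B.memLp_reward_mul_ratio hB i j).sub (memLp_const (B.mean i))).const_mul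
    (B.sigma i j)⁻¹
  refine h.ae_eq (Filter.Eventually.of_forall fun z => ?_)
  simp [score, div_eq_inv_mul]

lemma integrable_score (hB : B.ChiSquareFinite) (i j : Fin N) :
    Integrable (B.score i j) (B.law j) := by
  have := B.isProbabilityMeasure_law j
  exact (B.memLp_score hB i j).integrable one_le_two

lemma integral_reward_mul_ratio (hB : B.ChiSquareFinite) (i j : Fin N) :
    ∫ z, z.2.2 * B.ratio i j z.1 z.2.1 ∂B.law j = B.mean i := by
  rw [mean, ← B.integral_ratio_mul hB i j]
  exact integral_congr_ae (Filter.Eventually.of_forall fun z => mul_comm _ _)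

lemma integral_score (hB : B.ChiSquareFinite) (i j : Fin N) :
    ∫ z, B.score i j z ∂B.law j = 0 := by
  have := B.isProbabilityMeasure_law j
  simp only [score]
  rw [integral_div, integral_sub ((B.memLp_reward_mul_ratio hB i j).integrable one_le_two)
    (integrable_const _), B.integral_reward_mul_ratio hB]
  simp

/-- The variance is at most the second moment, and as rewards lie in [0,1] this is at most the
second moment of the ratio, which is `σ_ij²`. -/
lemma integral_score_sq_le (hB : B.ChiSquareFinite) (i j : Fin N) :
    ∫ z, B.score i j z ^ 2 ∂B.law j ≤ 1 := by
  have := B.isProbabilityMeasure_law j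
  have hL := B.memLp_reward_mul_ratio hB i j
  have hs := B.sigma_pos hB i j
  have h1 : ∫ z, (z.2.2 * B.ratio i j z.1 z.2.1 - B.mean i) ^ 2 ∂B.law j =
      ∫ z, (z.2.2 * B.ratio i j z.1 z.2.1) ^ 2 ∂B.law j - B.mean i ^ 2 := by
    rw [integral_sub_const_sq hL, B.integral_reward_mul_ratio hB]
    ring
  have h3 : ∫ z, (z.2.2 * B.ratio i j z.1 z.2.1) ^ 2 ∂B.law j ≤ B.sigma i j ^ 2 := by
    rw [B.sigma_sq hB]
    refine integral_mono_ae hL.integrable_sq (B.memLp_ratio hB i j).integrable_sq ?_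
    filter_upwards [B.ae_law_reward_mem j] with z hz
    show (z.2.2 * B.ratio i j z.1 z.2.1) ^ 2 ≤ B.ratio i j z.1 z.2.1 ^ 2
    have := B.ratio_nonneg i j z.1 z.2.1
    exact pow_le_pow_left₀ (mul_nonneg hz.1 this) (mul_le_of_le_one_left this hz.2) 2
  simp only [score, div_pow]
  rw [integral_div, h1, div_le_one (by positivity)]
  nlinarith [sq_nonneg (B.mean i)]

/-- Reward times ratio is nonnegative, and the mean is at most `1 ≤ σ_ij`. This one-sided bound is
what permits exponential moments for downward deviations. -/
lemma ae_law_neg_one_le_score (hB : B.ChiSquareFinite) (i j : Fin N) :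
    ∀ᵐ z ∂B.law j, -1 ≤ B.score i j z := by
  filter_upwards [B.ae_law_reward_mem j] with z hz
  have hs := B.one_le_sigma hB i j
  rw [score, le_div_iff₀ (by linarith)]
  have := mul_nonneg hz.1 (B.ratio_nonneg i j z.1 z.2.1)
  linarith [(B.mean_mem i).2]

end ExpertBandit

/-! ### Group statistics and the product supermartingale -/

namespace Division

variable {N : ℕ} (D : Division N)

/-- The number of the samples of the times `1, …, s` that go to group `r` of the division made at
time `t`. -/
def groupCount (t : ℕ) (h : ℕ → Fin N) (r s : ℕ) : ℕ :=
  ∑ u ∈ Finset.Icc 1 s, if D.assign t h u = r then 1 else 0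

/-- The sum of the scores `d` of the samples of the times `1, …, s` that go to group `r` of the
division made at time `t`. -/
def groupSum {α : Type*} (d : Fin N → α → ℝ) (t : ℕ) (h : ℕ → Fin N) (z : ℕ → α) (r s : ℕ) : ℝ :=
  ∑ u ∈ Finset.Icc 1 s, if D.assign t h u = r then d (h u) (z u) else 0

end Division

section

variable {Ω 𝒳 : Type*} [MeasurableSpace 𝒳] {K N : ℕ}
  {k : ℕ → Ω → Fin N} {Z : ℕ → Ω → 𝒳 × Fin K × ℝ}

lemma measurable_expert_pastInfo {s u : ℕ} (hu : u ∈ Finset.Ico 1 s) :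
    Measurable[pastInfo k Z s] (k u) :=
  Measurable.of_comap_le (le_sup_left.trans (le_iSup₂_of_le u hu le_rfl))

lemma measurable_obs_pastInfo {s u : ℕ} (hu : u ∈ Finset.Ico 1 s) :
    Measurable[pastInfo k Z s] (Z u) :=
  Measurable.of_comap_le (le_sup_right.trans (le_iSup₂_of_le u hu le_rfl))

/-- A finite history of experts takes values in a discrete space, so every function of it is
measurable; `j` only fills in the irrelevant times. -/
lemma measurable_of_expert_history {β : Type*} [MeasurableSpace β] {s : ℕ} (j : Fin N)
    {φ : (ℕ → Fin N) → β} (hφ : ∀ h h', (∀ u ∈ Finset.Ico 1 s, h u = h' u) → φ h = φ h') :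
    Measurable[pastInfo k Z s] fun ω => φ fun u => k u ω := by
  have h1 : Measurable[pastInfo k Z s] fun ω => fun u : Finset.Ico 1 s => k u ω :=
    @measurable_pi_lambda _ _ _ (pastInfo k Z s) _ _ fun u => measurable_expert_pastInfo u.2
  have h2 : Measurable fun c : Finset.Ico 1 s → Fin N =>
      φ fun u => if hu : u ∈ Finset.Ico 1 s then c ⟨u, hu⟩ else j := Measurable.of_discrete
  have h3 := h2.comp h1
  convert h3 using 1
  funext ω
  exact hφ _ _ fun u hu => by simp only [dif_pos hu]

lemma measurable_groupCount {D : Division N} {s : ℕ} (j : Fin N) (t r : ℕ) :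
    Measurable[pastInfo k Z (s + 1)] fun ω => D.groupCount t (fun u => k u ω) r s := by
  refine measurable_of_expert_history (φ := fun h => D.groupCount t h r s) j fun h h' hh => ?_
  refine Finset.sum_congr rfl fun u hu => ?_
  rw [D.assign_congr t h h' u fun v hv => hh v ?_]
  simp only [Finset.mem_Icc, Finset.mem_Ico] at *
  omega

lemma measurable_groupSum {D : Division N} {s : ℕ} (j : Fin N) (t r : ℕ) {d : Fin N → 𝒳 × Fin K × ℝ → ℝ}
    (hd : ∀ i, Measurable (d i)) :
    Measurable[pastInfo k Z (s + 1)] fun ω =>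
      D.groupSum d t (fun u => k u ω) (fun u => Z u ω) r s := by
  refine Finset.measurable_fun_sum _ fun u hu => ?_
  have hu' : u ∈ Finset.Ico 1 (s + 1) := by
    simp only [Finset.mem_Icc, Finset.mem_Ico] at *
    omega
  have h1 : Measurable[pastInfo k Z (s + 1)] fun ω => D.assign t (fun u => k u ω) u := by
    refine measurable_of_expert_history (φ := fun h => D.assign t h u) j fun h h' hh => ?_
    refine D.assign_congr t h h' u fun v hv => hh v ?_
    simp only [Finset.mem_Icc, Finset.mem_Ico] at *
    omega
  have h2 : Measurable fun p : Fin N × 𝒳 × Fin K × ℝ => d p.1 p.2 :=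
    measurable_from_prod_countable_right hd
  have h3 := (measurable_expert_pastInfo (k := k) (Z := Z) hu').prodMk
    (measurable_obs_pastInfo (k := k) (Z := Z) hu')
  exact Measurable.ite (h1 (measurableSet_singleton r)) (h2.comp h3) measurable_const

/-- One step of the product supermartingale: only the group that receives the new sample changes. -/
lemma lintegral_prod_update_le {α : Type*} [MeasurableSpace α] {ν : Measure α}
    [IsProbabilityMeasure ν] {g : ℕ → ℝ → ENNReal} (hg : ∀ n, Measurable (g n)) {d : α → ℝ}
    (hd : Measurable d) (hstep : ∀ n x, ∫⁻ z, g (n + 1) (x + d z) ∂ν ≤ g n x) (l a : ℕ)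
    (n : ℕ → ℕ) (x : ℕ → ℝ) :
    ∫⁻ z, ∏ r ∈ Finset.range l, (1 + g (n r + if a = r then 1 else 0)
      (x r + if a = r then d z else 0)) ∂ν ≤ ∏ r ∈ Finset.range l, (1 + g (n r) (x r)) := by
  by_cases ha : a ∈ Finset.range l
  · have hrest : ∀ z, ∏ r ∈ (Finset.range l).erase a, (1 + g (n r + if a = r then 1 else 0)
        (x r + if a = r then d z else 0)) =
        ∏ r ∈ (Finset.range l).erase a, (1 + g (n r) (x r)) := fun z =>
      Finset.prod_congr rfl fun r hr => by simp [(Finset.ne_of_mem_erase hr).symm]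
    simp_rw [← Finset.mul_prod_erase _ _ ha, hrest]
    have hm : Measurable fun z => g (n a + 1) (x a + d z) := (hg _).comp (hd.const_add _)
    simp only [if_true]
    have hm' : Measurable fun z => 1 + g (n a + 1) (x a + d z) := measurable_const.add hm
    rw [lintegral_mul_const _ hm', lintegral_add_left measurable_const]
    simp only [lintegral_const, measure_univ, mul_one]
    gcongr
    exact hstep (n a) (x a)
  · have : ∀ z, ∏ r ∈ Finset.range l, (1 + g (n r + if a = r then 1 else 0)
        (x r + if a = r then d z else 0)) = ∏ r ∈ Finset.range l, (1 + g (n r) (x r)) := fun z =>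
      Finset.prod_congr rfl fun r hr => by
        have : a ≠ r := fun h => ha (h ▸ hr)
        simp [this]
    simp [this]

namespace IsDUCBRun

variable [mΩ : MeasurableSpace Ω] {B : ExpertBandit 𝒳 K N} {D : Division N} {P : Measure Ω}

lemma pastInfo_le (hrun : IsDUCBRun B D P k Z) (s : ℕ) : pastInfo k Z s ≤ mΩ :=
  iSup₂_le fun u _ => sup_le (hrun.measurable_expert u).comap_le (hrun.measurable_obs u).comap_le

/-- Given the past and the choice of expert `j`, the observation is integrated out by `p_j`. -/
lemma setLIntegral_observe [IsProbabilityMeasure P] (hrun : IsDUCBRun B D P k Z) {s : ℕ}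
    (hs : 1 ≤ s) (j : Fin N) {E : Type*} [MeasurableSpace E] {X : Ω → E}
    (hX : Measurable[pastInfo k Z s] X) {f : E × 𝒳 × Fin K × ℝ → ENNReal} (hf : Measurable f) :
    ∫⁻ ω in k s ⁻¹' {j}, f (X ω, Z s ω) ∂P =
      ∫⁻ ω in k s ⁻¹' {j}, ∫⁻ z, f (X ω, z) ∂B.law j ∂P := by
  have := B.isProbabilityMeasure_law j
  have hX' : Measurable X := hX.mono (hrun.pastInfo_le s) le_rfl
  have hZ := hrun.measurable_obs s
  have hk : MeasurableSet (k s ⁻¹' {j}) := hrun.measurable_expert s (measurableSet_singleton j)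
  -- `observe` is the product formula on rectangles, which determines the joint law of `X` and `Z s`
  -- on the event.
  have hprod : ((P.restrict (k s ⁻¹' {j})).map X).prod (B.law j) =
      (P.restrict (k s ⁻¹' {j})).map fun ω => (X ω, Z s ω) := by
    refine Measure.prod_eq fun U S hU hS => ?_
    rw [Measure.map_apply (hX'.prodMk hZ) (hU.prod hS), Measure.map_apply hX' hU,
      Measure.restrict_apply (hX' hU),
      Measure.restrict_apply ((hX'.prodMk hZ) (hU.prod hS)), ← hrun.observe s hs _ (hX hU) j S hS]
    congr 1
    ext ω
    simp
    tauto
  rw [← lintegral_map (f := f) hf (hX'.prodMk hZ), ← hprod, lintegral_prod _ hf.aemeasurable,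
    lintegral_map hf.lintegral_prod_right' hX']

lemma lintegral_fiber (hrun : IsDUCBRun B D P k Z) (s : ℕ) (F : Ω → ENNReal) :
    ∫⁻ ω, F ω ∂P = ∑ j, ∫⁻ ω in k s ⁻¹' {j}, F ω ∂P := by
  rw [← tsum_fintype (L := .unconditional _), ← lintegral_iUnion
    (fun j => hrun.measurable_expert s (measurableSet_singleton j))
    (fun i j hij => Set.disjoint_left.2 fun ω hi hj => hij (hi.symm.trans hj)),
    ← Set.preimage_iUnion, Set.iUnion_of_singleton, Set.preimage_univ, Measure.restrict_univ]

/-- The product over the groups of `1 + g(count, sum)` does not increase in expectation. -/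
lemma lintegral_prod_group_le [IsProbabilityMeasure P] (hrun : IsDUCBRun B D P k Z)
    {g : ℕ → ℝ → ENNReal} (hg : ∀ n, Measurable (g n)) {d : Fin N → 𝒳 × Fin K × ℝ → ℝ}
    (hd : ∀ j, Measurable (d j))
    (hstep : ∀ j n x, ∫⁻ z, g (n + 1) (x + d j z) ∂B.law j ≤ g n x) (t l s : ℕ) :
    ∫⁻ ω, ∏ r ∈ Finset.range l, (1 + g (D.groupCount t (fun u => k u ω) r s)
      (D.groupSum d t (fun u => k u ω) (fun u => Z u ω) r s)) ∂P ≤ (1 + g 0 0) ^ l := by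
  induction s with
  | zero => simp [Division.groupCount, Division.groupSum]
  | succ s ih =>
    refine le_trans ?_ ih
    rw [hrun.lintegral_fiber (s + 1),
      hrun.lintegral_fiber (s + 1) fun ω => ∏ r ∈ Finset.range l,
        (1 + g (D.groupCount t (fun u => k u ω) r s)
          (D.groupSum d t (fun u => k u ω) (fun u => Z u ω) r s))]
    refine Finset.sum_le_sum fun j _ => ?_
    have := B.isProbabilityMeasure_law j
    -- The group of sample `s + 1` may depend on the expert of time `s + 1`. Overwriting that expert
    -- by `j` makes the group a function of the past, and changes nothing on the event `k (s + 1) =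
    -- j`.
    let X : Ω → (ℕ → ℕ) × (ℕ → ℝ) × ℕ := fun ω =>
      (fun r => D.groupCount t (fun u => k u ω) r s,
        fun r => D.groupSum d t (fun u => k u ω) (fun u => Z u ω) r s,
        D.assign t (Function.update (fun u => k u ω) (s + 1) j) (s + 1))
    let f : ((ℕ → ℕ) × (ℕ → ℝ) × ℕ) × 𝒳 × Fin K × ℝ → ENNReal := fun q =>
      ∏ r ∈ Finset.range l, (1 + g (q.1.1 r + if q.1.2.2 = r then 1 else 0)
        (q.1.2.1 r + if q.1.2.2 = r then d j q.2 else 0))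
    have hX : Measurable[pastInfo k Z (s + 1)] X := by
      have h1 : Measurable[pastInfo k Z (s + 1)] fun ω => (X ω).1 :=
        @measurable_pi_lambda _ _ _ (pastInfo k Z (s + 1)) _ _ fun r => measurable_groupCount j t r
      have h2 : Measurable[pastInfo k Z (s + 1)] fun ω => (X ω).2.1 :=
        @measurable_pi_lambda _ _ _ (pastInfo k Z (s + 1)) _ _ fun r =>
          measurable_groupSum j t r hd
      refine h1.prodMk (h2.prodMk ?_)
      refine measurable_of_expert_history
        (φ := fun h => D.assign t (Function.update h (s + 1) j) (s + 1)) j fun h h' hh => ?_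
      refine D.assign_congr _ _ _ _ fun u hu => ?_
      by_cases hus : u = s + 1
      · simp [hus]
      · simp only [Function.update_of_ne hus]
        refine hh u ?_
        simp only [Finset.mem_Icc, Finset.mem_Ico] at *
        omega
    have hf : Measurable f := by
      refine Finset.measurable_fun_prod _ fun r _ => ?_
      refine Measurable.const_add ?_ 1
      have hg' : Measurable fun p : ℕ × ℝ => g p.1 p.2 := measurable_from_prod_countable_right hg
      have hset : MeasurableSet {q : ((ℕ → ℕ) × (ℕ → ℝ) × ℕ) × 𝒳 × Fin K × ℝ | q.1.2.2 = r} :=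
        (measurable_snd.comp (measurable_snd.comp measurable_fst)) (measurableSet_singleton r)
      refine hg'.comp (Measurable.prodMk ?_ ?_)
      · exact ((measurable_pi_apply r).comp (measurable_fst.comp measurable_fst)).add
          (Measurable.ite hset measurable_const measurable_const)
      · exact ((measurable_pi_apply r).comp
          (measurable_fst.comp (measurable_snd.comp measurable_fst))).add
          (Measurable.ite hset ((hd j).comp measurable_snd) measurable_const)
    have hk : MeasurableSet (k (s + 1) ⁻¹' {j}) :=
      hrun.measurable_expert _ (measurableSet_singleton j)
    calc _ = ∫⁻ ω in k (s + 1) ⁻¹' {j}, f (X ω, Z (s + 1) ω) ∂P := by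
          refine setLIntegral_congr_fun hk fun ω hω => ?_
          have hω' : k (s + 1) ω = j := hω
          have hup : Function.update (fun u => k u ω) (s + 1) j = fun u => k u ω := by
            rw [← hω']
            exact Function.update_eq_self (s + 1) fun u => k u ω
          simp only [f, X, hup, Division.groupCount, Division.groupSum,
            Finset.sum_Icc_succ_top (Nat.le_add_left 1 s), hω']
      _ = ∫⁻ ω in k (s + 1) ⁻¹' {j}, ∫⁻ z, f (X ω, z) ∂B.law j ∂P :=
          hrun.setLIntegral_observe (Nat.le_add_left 1 s) j hX hf
      _ ≤ _ := lintegral_mono fun ω => lintegral_prod_update_le hg (hd j) (hstep j) l _ _ _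

end IsDUCBRun

end

/-! ### Medians and an exponential inequality -/

/-- The lower of the two middle entries is at most their mean, so it and all entries sorted before
it lie below `c`. -/
lemma card_le_two_mul_of_median_lt {n : ℕ} (hn : 0 < n) {f : Fin n → ℝ} {c : ℝ}
    (h : median f < c) : n ≤ 2 * (Finset.univ.filter fun r => f r < c).card := by
  rw [median, dif_pos hn] at h
  have hmono := Tuple.monotone_sort f
  have hab : f (Tuple.sort f ⟨(n - 1) / 2, by omega⟩) ≤ f (Tuple.sort f ⟨n / 2, by omega⟩) :=
    hmono (Fin.mk_le_mk.2 (by omega))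
  have hcard : (Finset.Iic (⟨(n - 1) / 2, by omega⟩ : Fin n)).card ≤
      (Finset.univ.filter fun r => f r < c).card := by
    refine Finset.card_le_card_of_injOn (Tuple.sort f) (fun i hi => ?_)
      (Tuple.sort f).injective.injOn
    have hi' := hmono (Finset.mem_Iic.1 hi)
    simp only [Function.comp_apply] at hi'
    simp only [Finset.coe_filter, Finset.mem_univ, true_and, Set.mem_ofPred_eq]
    linarith
  rw [Fin.card_Iic] at hcard
  simp only at hcard
  omega

lemma card_le_two_mul_of_le_median {n : ℕ} (hn : 0 < n) {f : Fin n → ℝ} {c : ℝ}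
    (h : c ≤ median f) : n ≤ 2 * (Finset.univ.filter fun r => c ≤ f r).card := by
  rw [median, dif_pos hn] at h
  have hmono := Tuple.monotone_sort f
  have hab : f (Tuple.sort f ⟨(n - 1) / 2, by omega⟩) ≤ f (Tuple.sort f ⟨n / 2, by omega⟩) :=
    hmono (Fin.mk_le_mk.2 (by omega))
  have hcard : (Finset.Ici (⟨n / 2, by omega⟩ : Fin n)).card ≤
      (Finset.univ.filter fun r => c ≤ f r).card := by
    refine Finset.card_le_card_of_injOn (Tuple.sort f) (fun i hi => ?_)
      (Tuple.sort f).injective.injOn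
    have hi' := hmono (Finset.mem_Ici.1 hi)
    simp only [Function.comp_apply] at hi'
    simp only [Finset.coe_filter, Finset.mem_univ, true_and, Set.mem_ofPred_eq]
    linarith
  rw [Fin.card_Ici] at hcard
  simp only at hcard
  omega

/-- For `x ≥ 0` the Taylor remainder is at most `2x³/9 ≤ x²/9`, and 1/2 + 1/9 < 5/8. For `x ≤ 0`
even 1/2 suffices, because `(1 + x + x²/2)(1 - x + x²/2) = 1 + x⁴/4`. -/
lemma exp_le_one_add_add_sq {x : ℝ} (hx : x ≤ 1 / 2) : Real.exp x ≤ 1 + x + 5 / 8 * x ^ 2 := by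
  rcases le_total 0 x with h0 | h0
  · have h := Real.exp_bound' h0 (by linarith) (n := 3) (by norm_num)
    simp [Finset.sum_range_succ, Nat.factorial] at h
    nlinarith [mul_nonneg (sq_nonneg x) (sub_nonneg.2 hx)]
  · have h := Real.quadratic_le_exp_of_nonneg (neg_nonneg.2 h0)
    have hprod : Real.exp x * Real.exp (-x) = 1 := by rw [← Real.exp_add]; simp
    have hpos : 0 < 1 + -x + (-x) ^ 2 / 2 := by nlinarith [sq_nonneg x]
    have h1 : Real.exp x * (1 + -x + (-x) ^ 2 / 2) ≤ 1 :=
      (mul_le_mul_of_nonneg_left h (Real.exp_pos x).le).trans hprod.le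
    have h2 : 1 ≤ (1 + x + x ^ 2 / 2) * (1 + -x + (-x) ^ 2 / 2) := by
      nlinarith [sq_nonneg (x ^ 2)]
    have h3 : Real.exp x ≤ 1 + x + x ^ 2 / 2 := le_of_mul_le_mul_right (h1.trans h2) hpos
    nlinarith [sq_nonneg x]

/-! ### From a deviating median to deviating groups -/

namespace Division

variable {N : ℕ} (D : Division N)

lemma sum_samples (t : ℕ) (h : ℕ → Fin N) (r : ℕ) (φ : Fin N → ℕ → ℝ) :
    ∑ j, ∑ s ∈ D.samples t h r j, φ j s =
      ∑ u ∈ Finset.Icc 1 t, if D.assign t h u = r then φ (h u) u else 0 := by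
  simp only [samples, Finset.sum_filter]
  rw [Finset.sum_comm]
  refine Finset.sum_congr rfl fun u _ => ?_
  simp [ite_and]

lemma size_eq_groupCount (t : ℕ) (h : ℕ → Fin N) (r : ℕ) :
    D.size t h r = D.groupCount t h r t := by
  have := D.sum_samples t h r fun _ _ => 1
  have h2 : ((D.size t h r : ℕ) : ℝ) = (D.groupCount t h r t : ℕ) := by
    simpa [size, groupCount] using this
  exact_mod_cast h2

lemma le_groupCount {t r : ℕ} (h : ℕ → Fin N) (hr : r < numGroups t) :
    t / (2 * numGroups t) ≤ D.groupCount t h r t := by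
  simpa [groupCount] using D.group_size t h r hr

lemma groupSum_neg {α : Type*} (d : Fin N → α → ℝ) (t : ℕ) (h : ℕ → Fin N) (z : ℕ → α)
    (r s : ℕ) : D.groupSum (fun j a => -d j a) t h z r s = -D.groupSum d t h z r s := by
  simp only [groupSum, ← Finset.sum_neg_distrib]
  exact Finset.sum_congr rfl fun u _ => by split_ifs <;> simp

end Division

namespace ExpertBandit

variable {𝒳 : Type*} [MeasurableSpace 𝒳] {K N : ℕ} (B : ExpertBandit 𝒳 K N) (D : Division N)

lemma groupWeight_eq (t : ℕ) (h : ℕ → Fin N) (i : Fin N) (r : ℕ) :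
    B.groupWeight D t h i r =
      ∑ u ∈ Finset.Icc 1 t, if D.assign t h u = r then 1 / B.sigma i (h u) else 0 := by
  rw [← D.sum_samples t h r fun j _ => 1 / B.sigma i j]
  simp [groupWeight, div_eq_mul_inv]

lemma groupCount_le_sigmaMax_mul_groupWeight (hB : B.ChiSquareFinite) (t : ℕ) (h : ℕ → Fin N)
    (i : Fin N) (r : ℕ) :
    (D.groupCount t h r t : ℝ) ≤ B.sigmaMax * B.groupWeight D t h i r := by
  rw [groupWeight_eq, Division.groupCount, Finset.mul_sum]
  push_cast
  refine Finset.sum_le_sum fun u _ => ?_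
  split_ifs
  · rw [mul_one_div, le_div_iff₀ (B.sigma_pos hB _ _), one_mul]
    exact B.sigma_le_sigmaMax _ _
  · simp

/-- The weights `1/σ_ij` of the estimator are exactly those that normalize the scores, so its
weighted error is a plain sum of scores. -/
lemma groupSum_score (t : ℕ) (h : ℕ → Fin N) (z : ℕ → 𝒳 × Fin K × ℝ)
    (i : Fin N) (r : ℕ) (hW : B.groupWeight D t h i r ≠ 0) :
    D.groupSum (B.score i) t h z r t =
      B.groupWeight D t h i r * (B.groupMean D t h z i r - B.mean i) := by
  rw [groupMean, D.sum_samples t h r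
    fun j s => 1 / B.sigma i j * (z s).2.2 * B.ratio i j (z s).1 (z s).2.1, mul_sub, ← mul_assoc,
    mul_one_div_cancel hW, one_mul, groupWeight_eq, Finset.sum_mul, ← Finset.sum_sub_distrib,
    Division.groupSum]
  refine Finset.sum_congr rfl fun u _ => ?_
  split_ifs
  · rw [score]
    ring
  · simp

lemma sigmaMax_pos (hB : B.ChiSquareFinite) (i : Fin N) : 0 < B.sigmaMax :=
  (B.sigma_pos hB i i).trans_le (B.sigma_le_sigmaMax i i)

section

variable {B D} {t : ℕ} {h : ℕ → Fin N}

lemma groupWeight_pos (hB : B.ChiSquareFinite) {r : ℕ} (hr : 1 ≤ D.size t h r) (i : Fin N) :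
    0 < B.groupWeight D t h i r := by
  have h1 := B.groupCount_le_sigmaMax_mul_groupWeight D hB t h i r
  rw [← D.size_eq_groupCount] at h1
  have h2 : (1 : ℝ) ≤ D.size t h r := by exact_mod_cast hr
  exact pos_of_mul_pos_right (by linarith) (B.sigmaMax_pos hB i).le

lemma inv_sigmaMax_le_minWeight (hB : B.ChiSquareFinite) (hl : 1 ≤ numGroups t)
    (hsize : ∀ r < numGroups t, 1 ≤ D.size t h r) (i : Fin N) :
    1 / B.sigmaMax ≤ B.minWeight D t h i := by
  have : Nonempty (Fin (numGroups t)) := ⟨⟨0, hl⟩⟩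
  refine le_ciInf fun r => ?_
  have h2 : (1 : ℝ) ≤ D.size t h r := by exact_mod_cast hsize r r.2
  rw [div_le_div_iff₀ (B.sigmaMax_pos hB i) (by linarith), one_mul, mul_comm,
    D.size_eq_groupCount]
  exact B.groupCount_le_sigmaMax_mul_groupWeight D hB t h i r

lemma minWeight_mul_groupCount_le (hsize : ∀ r < numGroups t, 1 ≤ D.size t h r) (i : Fin N)
    {r : ℕ} (hr : r < numGroups t) :
    B.minWeight D t h i * D.groupCount t h r t ≤ B.groupWeight D t h i r := by
  have h2 : (1 : ℝ) ≤ D.size t h r := by exact_mod_cast hsize r hr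
  rw [← le_div_iff₀ (by rw [← D.size_eq_groupCount]; linarith), ← D.size_eq_groupCount]
  exact ciInf_le (Set.finite_range fun r : Fin (numGroups t) =>
    B.groupWeight D t h i r / (D.size t h r : ℝ)).bddBelow ⟨r, hr⟩

/-- Since `minWeight` is a minimum over the groups, one common width serves every group. The
threshold for the sum of scores then depends on the group size alone, not on which experts were
followed. -/
lemma groupCount_mul_le_groupWeight_mul_width (hB : B.ChiSquareFinite) (hl : 1 ≤ numGroups t)
    (hsize : ∀ r < numGroups t, 1 ≤ D.size t h r) (i : Fin N) {r : ℕ} (hr : r < numGroups t) :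
    D.groupCount t h r t * √(64 * Real.log (1 / delta t) / t) ≤
      B.groupWeight D t h i r * B.width D t h i := by
  have hpos : 0 < B.minWeight D t h i :=
    (one_div_pos.2 (B.sigmaMax_pos hB i)).trans_le (inv_sigmaMax_le_minWeight hB hl hsize i)
  rw [width, ← mul_assoc]
  refine mul_le_mul_of_nonneg_right ?_ (Real.sqrt_nonneg _)
  rw [mul_one_div, le_div_iff₀ hpos, mul_comm]
  exact minWeight_mul_groupCount_le hsize i hr

lemma width_le (hB : B.ChiSquareFinite) (hl : 1 ≤ numGroups t)
    (hsize : ∀ r < numGroups t, 1 ≤ D.size t h r) (i : Fin N) :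
    B.width D t h i ≤ B.sigmaMax * √(64 * Real.log (1 / delta t) / t) := by
  refine mul_le_mul_of_nonneg_right ?_ (Real.sqrt_nonneg _)
  have hs := B.sigmaMax_pos hB i
  have hle := inv_sigmaMax_le_minWeight hB hl hsize i
  simpa using one_div_le_one_div_of_le (one_div_pos.2 hs) hle

/-- If the median of means falls below `μ_i` by more than the width, then half of the groups
deviate downwards. -/
lemma exists_groups_of_momEstimate_lt (hB : B.ChiSquareFinite) (hl : 1 ≤ numGroups t)
    (hsize : ∀ r < numGroups t, 1 ≤ D.size t h r) {z : ℕ → 𝒳 × Fin K × ℝ} {i : Fin N}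
    (hlt : B.momEstimate D t h z i < B.mean i - B.width D t h i) :
    ∃ A ⊆ Finset.range (numGroups t), numGroups t ≤ 2 * A.card ∧ ∀ r ∈ A,
      D.groupCount t h r t * √(64 * Real.log (1 / delta t) / t) ≤
        D.groupSum (fun j a => -B.score i j a) t h z r t := by
  have hcard := card_le_two_mul_of_median_lt hl hlt
  refine ⟨(Finset.univ.filter fun r : Fin (numGroups t) =>
    B.groupMean D t h z i r < B.mean i - B.width D t h i).map Fin.valEmbedding, ?_, ?_, ?_⟩
  · intro r hr
    simp only [Finset.mem_map, Fin.valEmbedding_apply] at hr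
    obtain ⟨a, -, rfl⟩ := hr
    simp
  · simpa using hcard
  · intro r hr
    simp only [Finset.mem_map, Finset.mem_filter, Finset.mem_univ, true_and,
      Fin.valEmbedding_apply] at hr
    obtain ⟨a, ha, rfl⟩ := hr
    have hW := groupWeight_pos hB (hsize a a.2) i
    rw [D.groupSum_neg, B.groupSum_score D t h z i a hW.ne', ← mul_neg]
    refine (groupCount_mul_le_groupWeight_mul_width hB hl hsize i a.2).trans ?_
    exact mul_le_mul_of_nonneg_left (by linarith) hW.le

/-- If the median of means exceeds `μ_i` by at least `c` times the width, then half of the groups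
deviate upwards. -/
lemma exists_groups_of_le_momEstimate (hB : B.ChiSquareFinite) (hl : 1 ≤ numGroups t)
    (hsize : ∀ r < numGroups t, 1 ≤ D.size t h r) {z : ℕ → 𝒳 × Fin K × ℝ} {i : Fin N} {c : ℝ}
    (hc : 0 ≤ c) (hle : B.mean i + c * B.width D t h i ≤ B.momEstimate D t h z i) :
    ∃ A ⊆ Finset.range (numGroups t), numGroups t ≤ 2 * A.card ∧ ∀ r ∈ A,
      c * (D.groupCount t h r t * √(64 * Real.log (1 / delta t) / t)) ≤
        D.groupSum (B.score i) t h z r t := by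
  have hcard := card_le_two_mul_of_le_median hl hle
  refine ⟨(Finset.univ.filter fun r : Fin (numGroups t) =>
    B.mean i + c * B.width D t h i ≤ B.groupMean D t h z i r).map Fin.valEmbedding, ?_, ?_, ?_⟩
  · intro r hr
    simp only [Finset.mem_map, Fin.valEmbedding_apply] at hr
    obtain ⟨a, -, rfl⟩ := hr
    simp
  · simpa using hcard
  · intro r hr
    simp only [Finset.mem_map, Finset.mem_filter, Finset.mem_univ, true_and,
      Fin.valEmbedding_apply] at hr
    obtain ⟨a, ha, rfl⟩ := hr
    have hW := groupWeight_pos hB (hsize a a.2) i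
    rw [B.groupSum_score D t h z i a hW.ne']
    refine (mul_le_mul_of_nonneg_left
      (groupCount_mul_le_groupWeight_mul_width hB hl hsize i a.2) hc).trans ?_
    rw [mul_left_comm]
    exact mul_le_mul_of_nonneg_left (by linarith) hW.le

end

end ExpertBandit

/-! ### Number and size of the groups -/

lemma log_one_div_delta (t : ℕ) : Real.log (1 / delta t) = 2 * Real.log t := by
  rw [delta, one_div_one_div, Real.log_pow]
  norm_num

lemma numGroups_le (t : ℕ) : (numGroups t : ℝ) ≤ 16 * Real.log t := by
  have h : 0 ≤ Real.log t := Real.log_natCast_nonneg t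
  rw [numGroups, log_one_div_delta]
  refine (Nat.floor_le (by positivity)).trans (by linarith)

lemma lt_numGroups_add_one (t : ℕ) : 16 * Real.log t < numGroups t + 1 := by
  rw [numGroups, log_one_div_delta]
  linarith [Nat.lt_floor_add_one (8 * (2 * Real.log t))]

lemma one_le_log_of_le {t : ℕ} (ht : 64 ≤ t) : 1 ≤ Real.log t := by
  rw [Real.le_log_iff_exp_le (by positivity)]
  have : (64 : ℝ) ≤ t := by exact_mod_cast ht
  linarith [Real.exp_one_lt_d9]

/-- The groups are large enough compared with the squared width scale. -/
lemma le_group_size_mul {t : ℕ} (ht : 64 ≤ t) (hlog : 512 * Real.log t ≤ t) :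
    15 / 4 ≤ ((t / (2 * numGroups t) : ℕ) : ℝ) * (64 * Real.log (1 / delta t) / t) := by
  have hL := one_le_log_of_le ht
  have htpos : (0 : ℝ) < t := by linarith
  have hl1 : 1 ≤ numGroups t := by
    have : (0 : ℝ) < numGroups t := by linarith [lt_numGroups_add_one t]
    exact_mod_cast this
  have hl : (1 : ℝ) ≤ numGroups t := by exact_mod_cast hl1
  have h1 : (t : ℝ) < ((t / (2 * numGroups t) : ℕ) + 1) * (2 * numGroups t) := by
    have := Nat.lt_div_mul_add (a := t) (b := 2 * numGroups t) (by omega)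
    have h2 : t < (t / (2 * numGroups t) + 1) * (2 * numGroups t) := by linarith
    exact_mod_cast h2
  -- Without rounding, the product would be at least 128/32 = 4; rounding down costs at most `128
  -- log t / t ≤ 1/4`.
  have h3 : (t : ℝ) ≤ ((t / (2 * numGroups t) : ℕ) + 1) * (32 * Real.log t) :=
    h1.le.trans (mul_le_mul_of_nonneg_left (by linarith [numGroups_le t]) (by positivity))
  rw [log_one_div_delta, mul_div_assoc', le_div_iff₀ htpos]
  nlinarith

/-! ### The two potentials and their supermartingale property -/

section

variable {𝒳 : Type*} [MeasurableSpace 𝒳] {K N : ℕ}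

/-- The exponential potential that controls downward deviations. -/
noncomputable def expPotential (lam : ℝ) (n : ℕ) (x : ℝ) : ENNReal :=
  ENNReal.ofReal (1 / 2 * Real.exp (lam * x - 5 / 8 * lam ^ 2 * n))

/-- The quadratic potential that controls upward deviations. -/
noncomputable def quadPotential (m : ℝ) (n : ℕ) (x : ℝ) : ENNReal :=
  ENNReal.ofReal (m / 2 * (x ^ 2 / (n + m) ^ 2 + 1 / (n + m)))

lemma measurable_expPotential (lam : ℝ) (n : ℕ) : Measurable (expPotential lam n) := by
  unfold expPotential
  fun_prop

lemma measurable_quadPotential (m : ℝ) (n : ℕ) : Measurable (quadPotential m n) := by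
  unfold quadPotential
  fun_prop

/-- As `-score ≤ 1` and `lam ≤ 1/2`, the quadratic bound on the exponential applies. With mean 0 and
variance at most 1, a sample multiplies the expectation by at most `1 + 5/8 lam²`, which the
compensator absorbs. -/
lemma lintegral_expPotential_le (B : ExpertBandit 𝒳 K N) (hB : B.ChiSquareFinite) {lam : ℝ}
    (h0 : 0 ≤ lam) (h1 : lam ≤ 1 / 2) (i j : Fin N) (n : ℕ) (x : ℝ) :
    ∫⁻ z, expPotential lam (n + 1) (x + -B.score i j z) ∂B.law j ≤ expPotential lam n x := by
  have := B.isProbabilityMeasure_law j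
  set c := 1 / 2 * Real.exp (lam * x - 5 / 8 * lam ^ 2 * n) with hc
  have hcpos : 0 ≤ c := by positivity
  set q : 𝒳 × Fin K × ℝ → ℝ := fun z =>
    c * Real.exp (-(5 / 8 * lam ^ 2)) *
      (1 - lam * B.score i j z + 5 / 8 * lam ^ 2 * B.score i j z ^ 2) with hq
  have hi := B.integrable_score hB i j
  have hi2 := (B.memLp_score hB i j).integrable_sq
  have hbound : ∀ᵐ z ∂B.law j,
      expPotential lam (n + 1) (x + -B.score i j z) ≤ ENNReal.ofReal (q z) := by
    filter_upwards [B.ae_law_neg_one_le_score hB i j] with z hz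
    refine ENNReal.ofReal_le_ofReal ?_
    have he := exp_le_one_add_add_sq (x := -(lam * B.score i j z)) (by nlinarith)
    have hsplit : 1 / 2 * Real.exp (lam * (x + -B.score i j z) - 5 / 8 * lam ^ 2 * (n + 1 : ℕ)) =
        c * Real.exp (-(5 / 8 * lam ^ 2)) * Real.exp (-(lam * B.score i j z)) := by
      rw [hc, mul_assoc (1 / 2 : ℝ), mul_assoc (1 / 2 : ℝ), ← Real.exp_add, ← Real.exp_add]
      push_cast
      ring_nf
    rw [hsplit]
    refine mul_le_mul_of_nonneg_left (he.trans (le_of_eq (by ring))) (by positivity)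
  have hint1 : Integrable (fun z => 1 - lam * B.score i j z) (B.law j) :=
    (integrable_const _).sub (hi.const_mul _)
  have hqi : Integrable q (B.law j) := (hint1.add (hi2.const_mul _)).const_mul _
  have hq0 : ∀ z, 0 ≤ q z := fun z => by
    refine mul_nonneg (by positivity) ?_
    nlinarith [sq_nonneg (lam * B.score i j z - 1)]
  refine (lintegral_mono_ae hbound).trans ?_
  rw [← ofReal_integral_eq_lintegral_ofReal hqi (Filter.Eventually.of_forall hq0), expPotential]
  refine ENNReal.ofReal_le_ofReal ?_
  rw [← hc]
  simp only [hq]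
  rw [integral_const_mul, integral_add hint1 (hi2.const_mul _),
    integral_sub (integrable_const _) (hi.const_mul _), integral_const_mul, integral_const_mul,
    B.integral_score hB]
  simp only [integral_const, probReal_univ, smul_eq_mul, mul_one, mul_zero, sub_zero]
  have hv := B.integral_score_sq_le hB i j
  have h2 : 1 + 5 / 8 * lam ^ 2 * ∫ z, B.score i j z ^ 2 ∂B.law j ≤
      Real.exp (5 / 8 * lam ^ 2) := by
    have := Real.add_one_le_exp (5 / 8 * lam ^ 2)
    nlinarith [sq_nonneg lam]
  calc _ ≤ c * Real.exp (-(5 / 8 * lam ^ 2)) * Real.exp (5 / 8 * lam ^ 2) :=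
        mul_le_mul_of_nonneg_left h2 (by positivity)
    _ = c := by rw [mul_assoc, ← Real.exp_add]; simp

/-- Dividing by `(n + m)²` handles random group sizes without fixing `n` beforehand. A sample raises
the expected square by at most 1, and `1/(s+1)² + 1/(s+1) ≤ 1/s` lets the second summand pay for it.
-/
lemma lintegral_quadPotential_le (B : ExpertBandit 𝒳 K N) (hB : B.ChiSquareFinite) {m : ℝ}
    (hm : 1 ≤ m) (i j : Fin N) (n : ℕ) (x : ℝ) :
    ∫⁻ z, quadPotential m (n + 1) (x + B.score i j z) ∂B.law j ≤ quadPotential m n x := by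
  have := B.isProbabilityMeasure_law j
  have hL := B.memLp_score hB i j
  have hsq : Integrable (fun z => (x + B.score i j z) ^ 2) (B.law j) :=
    ((memLp_const x).add hL).integrable_sq
  have hval : ∫ z, (x + B.score i j z) ^ 2 ∂B.law j ≤ x ^ 2 + 1 := by
    have h := integral_sub_const_sq hL (-x)
    rw [B.integral_score hB] at h
    have h2 : ∀ z, (x + B.score i j z) ^ 2 = (B.score i j z - -x) ^ 2 := fun z => by ring
    simp_rw [h2, h]
    nlinarith [B.integral_score_sq_le hB i j]
  have hs : (0 : ℝ) < n + m := by positivity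
  unfold quadPotential
  have hint : Integrable (fun z => m / 2 * ((x + B.score i j z) ^ 2 / ((n + 1 : ℕ) + m) ^ 2 +
      1 / ((n + 1 : ℕ) + m))) (B.law j) :=
    ((hsq.div_const _).add (integrable_const _)).const_mul _
  rw [← ofReal_integral_eq_lintegral_ofReal hint
    (Filter.Eventually.of_forall fun z => by positivity)]
  refine ENNReal.ofReal_le_ofReal ?_
  rw [integral_const_mul, integral_add (hsq.div_const _) (integrable_const _), integral_div]
  refine mul_le_mul_of_nonneg_left ?_ (by positivity)
  simp only [integral_const, probReal_univ, smul_eq_mul, one_mul]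
  push_cast
  have hsucc : ((n : ℝ) + 1 + m) = (n + m) + 1 := by ring
  rw [hsucc]
  generalize (n : ℝ) + m = s at hs
  calc _ ≤ (x ^ 2 + 1) / (s + 1) ^ 2 + 1 / (s + 1) := by gcongr
    _ = x ^ 2 / (s + 1) ^ 2 + (1 / (s + 1) ^ 2 + 1 / (s + 1)) := by ring
    _ ≤ x ^ 2 / s ^ 2 + 1 / s := by
      gcongr
      · linarith
      · rw [div_add_div _ _ (by positivity) (by positivity),
          div_le_div_iff₀ (by positivity) hs]
        nlinarith [pow_pos hs 2, pow_pos hs 3]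

end

/-! ### Deviation probabilities of the median of means -/

namespace IsDUCBRun

variable {Ω 𝒳 : Type*} [MeasurableSpace Ω] [MeasurableSpace 𝒳] {K N : ℕ}
  {B : ExpertBandit 𝒳 K N} {D : Division N} {P : Measure Ω} [IsProbabilityMeasure P]
  {k : ℕ → Ω → Fin N} {Z : ℕ → Ω → 𝒳 × Fin K × ℝ}

/-- The probability that half of the groups have a large potential is exponentially small in the
number of groups. -/
lemma measure_half_groups_le (hrun : IsDUCBRun B D P k Z) (i : Fin N)
    {g : ℕ → ℝ → ENNReal} (hg : ∀ n, Measurable (g n)) (hg0 : g 0 0 ≤ ENNReal.ofReal (1 / 2))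
    {d : Fin N → 𝒳 × Fin K × ℝ → ℝ} (hd : ∀ j, Measurable (d j))
    (hstep : ∀ j n x, ∫⁻ z, g (n + 1) (x + d j z) ∂B.law j ≤ g n x) (t l : ℕ) {S : Set Ω}
    (hS : ∀ ω ∈ S, ∃ A ⊆ Finset.range l, l ≤ 2 * A.card ∧ ∀ r ∈ A,
      2 ≤ g (D.groupCount t (fun u => k u ω) r t)
        (D.groupSum d t (fun u => k u ω) (fun u => Z u ω) r t)) :
    P.real S ≤ (√3 / 2) ^ l := by
  set F : Ω → ENNReal := fun ω => ∏ r ∈ Finset.range l,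
    (1 + g (D.groupCount t (fun u => k u ω) r t)
      (D.groupSum d t (fun u => k u ω) (fun u => Z u ω) r t)) with hF
  have hFm : Measurable F := by
    have hg' : Measurable fun p : ℕ × ℝ => g p.1 p.2 := measurable_from_prod_countable_right hg
    refine Finset.measurable_fun_prod _ fun r _ => Measurable.const_add ?_ 1
    exact hg'.comp (((measurable_groupCount i t r).mono (hrun.pastInfo_le _) le_rfl).prodMk
      ((measurable_groupSum i t r hd).mono (hrun.pastInfo_le _) le_rfl))
  -- Each deviating group contributes a factor at least 1 + 2 = 3, every other group a factor at
  -- least 1.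
  have hsub : S ⊆ {ω | ENNReal.ofReal (√3 ^ l) ≤ F ω} := by
    intro ω hω
    obtain ⟨A, hA, hcard, hbad⟩ := hS ω hω
    have h1 : √3 ^ l ≤ (3 : ℝ) ^ A.card := by
      calc √3 ^ l ≤ √3 ^ (2 * A.card) :=
            pow_le_pow_right₀ (Real.one_le_sqrt.2 (by norm_num)) hcard
        _ = 3 ^ A.card := by rw [pow_mul, Real.sq_sqrt (by norm_num)]
    calc ENNReal.ofReal (√3 ^ l) ≤ ENNReal.ofReal (3 ^ A.card) := ENNReal.ofReal_le_ofReal h1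
      _ = 3 ^ A.card := by rw [ENNReal.ofReal_pow (by norm_num)]; norm_num
      _ ≤ ∏ r ∈ A, (1 + g (D.groupCount t (fun u => k u ω) r t)
          (D.groupSum d t (fun u => k u ω) (fun u => Z u ω) r t)) := by
          refine Finset.pow_card_le_prod _ _ _ fun r hr => ?_
          calc (3 : ENNReal) = 1 + 2 := by norm_num
            _ ≤ _ := by gcongr; exact hbad r hr
      _ ≤ F ω := Finset.prod_le_prod_of_subset_of_one_le' hA fun r _ _ => le_self_add
  have hmarkov := (mul_meas_ge_le_lintegral₀ hFm.aemeasurable (ENNReal.ofReal (√3 ^ l))).trans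
    (hrun.lintegral_prod_group_le hg hd hstep t l t)
  have h3 : ENNReal.ofReal (√3 ^ l) * P S ≤ ENNReal.ofReal ((3 / 2) ^ l) := by
    refine (mul_le_mul_right (measure_mono hsub) _).trans (hmarkov.trans ?_)
    rw [ENNReal.ofReal_pow (by norm_num)]
    gcongr
    calc 1 + g 0 0 ≤ ENNReal.ofReal 1 + ENNReal.ofReal (1 / 2) := by
          rw [ENNReal.ofReal_one]; gcongr
      _ = ENNReal.ofReal (3 / 2) := by
          rw [← ENNReal.ofReal_add (by norm_num) (by norm_num)]; norm_num
  have h4 : √3 ^ l * P.real S ≤ (3 / 2) ^ l := by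
    have := ENNReal.toReal_mono ENNReal.ofReal_ne_top h3
    rwa [ENNReal.toReal_mul, ENNReal.toReal_ofReal (by positivity),
      ENNReal.toReal_ofReal (by positivity)] at this
  have hpos : (0 : ℝ) < √3 ^ l := by positivity
  have hid : (√3 / 2) ^ l * √3 ^ l = (3 / 2) ^ l := by
    rw [← mul_pow]
    congr 1
    nlinarith [Real.sq_sqrt (show (0 : ℝ) ≤ 3 by norm_num)]
  refine le_of_mul_le_mul_right ?_ hpos
  rw [hid, mul_comm]
  exact h4

/-- `√3/2 ≤ exp (-1/8)` matches the `16 log t` groups; rounding their number down costs at most a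
factor `exp (1/8) ≤ 2`. -/
lemma sqrt_three_div_two_pow_le {t : ℕ} (ht : 1 ≤ t) :
    (√3 / 2) ^ numGroups t ≤ 2 / (t : ℝ) ^ 2 := by
  have htpos : (0 : ℝ) < t := by exact_mod_cast ht
  have h1 : √3 / 2 ≤ Real.exp (-(1 / 8)) := by
    have hexp : (3 / 4 : ℝ) ≤ Real.exp (-(1 / 4)) := by
      linarith [Real.add_one_le_exp (-(1 / 4 : ℝ))]
    refine abs_le_of_sq_le_sq' ?_ (Real.exp_pos _).le |>.2
    rw [div_pow, Real.sq_sqrt (by norm_num), ← Real.exp_nat_mul]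
    norm_num at hexp ⊢
    linarith
  have h2 : Real.exp (1 / 8) ≤ 2 := by
    have := exp_le_one_add_add_sq (x := 1 / 8) (by norm_num)
    linarith
  calc (√3 / 2) ^ numGroups t ≤ Real.exp (-(1 / 8)) ^ numGroups t := by gcongr
    _ = Real.exp (-(numGroups t / 8)) := by rw [← Real.exp_nat_mul]; ring_nf
    _ ≤ Real.exp (1 / 8 - 2 * Real.log t) :=
        Real.exp_le_exp.2 (by linarith [lt_numGroups_add_one t])
    _ = Real.exp (1 / 8) / (t : ℝ) ^ 2 := by
        rw [Real.exp_sub, two_mul, Real.exp_add, Real.exp_log htpos, sq]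
    _ ≤ 2 / (t : ℝ) ^ 2 := by gcongr

lemma measure_downward_le (hrun : IsDUCBRun B D P k Z) (hB : B.ChiSquareFinite) (i : Fin N)
    {t : ℕ} (ht : 64 ≤ t) (hlog : 512 * Real.log t ≤ t) {S : Set Ω}
    (hS : ∀ ω ∈ S, ∃ A ⊆ Finset.range (numGroups t), numGroups t ≤ 2 * A.card ∧ ∀ r ∈ A,
      D.groupCount t (fun u => k u ω) r t * √(64 * Real.log (1 / delta t) / t) ≤
        D.groupSum (fun j a => -B.score i j a) t (fun u => k u ω) (fun u => Z u ω) r t) :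
    P.real S ≤ 2 / (t : ℝ) ^ 2 := by
  have htpos : (0 : ℝ) < t := by exact_mod_cast (by omega : 0 < t)
  have hL := one_le_log_of_le ht
  set v := 64 * Real.log (1 / delta t) / t with hv
  have hv0 : 0 ≤ v := by rw [hv, log_one_div_delta]; positivity
  have hv1 : v ≤ 1 / 4 := by
    rw [hv, log_one_div_delta, div_le_iff₀ htpos]
    linarith
  have hs1 : √v ≤ 1 / 2 := by
    rw [Real.sqrt_le_left (by norm_num)]
    linarith
  have hsq := Real.sq_sqrt hv0
  have hm := le_group_size_mul ht hlog
  -- The slope `4/5 √v` maximizes `lam √v - 5/8 lam²`. It gives the exponent `2/5 n v ≥ 3/2`, and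
  -- `exp (3/2) ≥ 4` makes the potential at least 2.
  refine (hrun.measure_half_groups_le i (measurable_expPotential (4 / 5 * √v)) ?_
    (fun j => (B.measurable_score i j).neg)
    (fun j n x => lintegral_expPotential_le B hB (by positivity) (by linarith) i j n x)
    t (numGroups t) ?_).trans (sqrt_three_div_two_pow_le (by omega))
  · simp [expPotential]
  · intro ω hω
    obtain ⟨A, hA, hcard, hbad⟩ := hS ω hω
    refine ⟨A, hA, hcard, fun r hr => ?_⟩
    have hn : 15 / 4 ≤ (D.groupCount t (fun u => k u ω) r t : ℝ) * v := by
      refine hm.trans (mul_le_mul_of_nonneg_right ?_ hv0)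
      exact_mod_cast D.le_groupCount _ (Finset.mem_range.1 (hA hr))
    have hx := hbad r hr
    simp only [expPotential]
    generalize D.groupSum _ t _ _ r t = x at *
    generalize ((D.groupCount t _ r t : ℕ) : ℝ) = n at *
    have hexp : 4 ≤ Real.exp (4 / 5 * √v * x - 5 / 8 * (4 / 5 * √v) ^ 2 * n) := by
      have h1 : 3 / 2 ≤ 4 / 5 * √v * x - 5 / 8 * (4 / 5 * √v) ^ 2 * n := by
        have h2 : √v * (n * √v) ≤ √v * x := mul_le_mul_of_nonneg_left hx (Real.sqrt_nonneg v)
        have h3 : √v * (n * √v) = n * v := by rw [← hsq]; ring_nf; simp [hsq]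
        have h4 : 5 / 8 * (4 / 5 * √v) ^ 2 * n = 2 / 5 * (n * v) := by
          rw [mul_pow, hsq]; ring
        linarith
      have h5 : (4 : ℝ) ≤ Real.exp (3 / 2) := by
        have h6 : Real.exp (3 / 2) = Real.exp 1 * Real.exp (1 / 2) := by
          rw [← Real.exp_add]; norm_num
        have h7 := Real.quadratic_le_exp_of_nonneg (x := 1 / 2) (by norm_num)
        have h8 := Real.exp_one_gt_d9
        rw [h6]
        nlinarith
      exact h5.trans (Real.exp_le_exp.2 h1)
    calc (2 : ENNReal) = ENNReal.ofReal 2 := by simp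
      _ ≤ _ := ENNReal.ofReal_le_ofReal (by linarith)

lemma measure_upward_le (hrun : IsDUCBRun B D P k Z) (hB : B.ChiSquareFinite) (i : Fin N)
    {t : ℕ} (ht : 64 ≤ t) (hlog : 512 * Real.log t ≤ t) {S : Set Ω}
    (hS : ∀ ω ∈ S, ∃ A ⊆ Finset.range (numGroups t), numGroups t ≤ 2 * A.card ∧ ∀ r ∈ A,
      3 * (D.groupCount t (fun u => k u ω) r t * √(64 * Real.log (1 / delta t) / t)) ≤
        D.groupSum (B.score i) t (fun u => k u ω) (fun u => Z u ω) r t) :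
    P.real S ≤ 2 / (t : ℝ) ^ 2 := by
  have htpos : (0 : ℝ) < t := by exact_mod_cast (by omega : 0 < t)
  have hL := one_le_log_of_le ht
  have hm := le_group_size_mul ht hlog
  set v := 64 * Real.log (1 / delta t) / t with hv
  have hv0 : 0 ≤ v := by rw [hv, log_one_div_delta]; positivity
  have hsq := Real.sq_sqrt hv0
  -- Taking for `m` the guaranteed group size gives `n + m ≤ 2 n`, so a deviation of three widths
  -- makes the potential at least `9/8 m v ≥ 2`.
  set m := t / (2 * numGroups t) with hmdef
  have hm1 : (1 : ℝ) ≤ m := by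
    have : m ≠ 0 := fun h => by rw [h] at hm; norm_num at hm
    exact_mod_cast Nat.one_le_iff_ne_zero.2 this
  refine (hrun.measure_half_groups_le i (measurable_quadPotential m) ?_
    (fun j => B.measurable_score i j)
    (fun j n x => lintegral_quadPotential_le B hB hm1 i j n x)
    t (numGroups t) ?_).trans (sqrt_three_div_two_pow_le (by omega))
  · refine ENNReal.ofReal_le_ofReal (le_of_eq ?_)
    have : (m : ℝ) ≠ 0 := by linarith
    field_simp
    simp [sq]
  · intro ω hω
    obtain ⟨A, hA, hcard, hbad⟩ := hS ω hω
    refine ⟨A, hA, hcard, fun r hr => ?_⟩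
    have hn : (m : ℝ) ≤ (D.groupCount t (fun u => k u ω) r t : ℝ) := by
      exact_mod_cast D.le_groupCount _ (Finset.mem_range.1 (hA hr))
    have hx := hbad r hr
    simp only [quadPotential]
    generalize D.groupSum _ t _ _ r t = x at *
    generalize ((D.groupCount t _ r t : ℕ) : ℝ) = n at *
    generalize (m : ℝ) = m at *
    have hnpos : 0 < n := by linarith
    have h1 : 9 / 4 * v ≤ x ^ 2 / (n + m) ^ 2 := by
      rw [le_div_iff₀ (by positivity)]
      have h2 : (3 * (n * √v)) ^ 2 ≤ x ^ 2 := pow_le_pow_left₀ (by positivity) hx 2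
      have h3 : (3 * (n * √v)) ^ 2 = 9 * (n ^ 2 * v) := by rw [mul_pow, mul_pow, hsq]; ring
      have h4 : (n + m) ^ 2 ≤ 4 * n ^ 2 := by nlinarith
      nlinarith
    have h5 : 0 ≤ 1 / (n + m) := by positivity
    calc (2 : ENNReal) = ENNReal.ofReal 2 := by simp
      _ ≤ _ := ENNReal.ofReal_le_ofReal (by nlinarith)

end IsDUCBRun

/-! ### Sorted gaps -/

namespace ExpertBandit

variable {𝒳 : Type*} [MeasurableSpace 𝒳] {K N : ℕ} (B : ExpertBandit 𝒳 K N)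

lemma exists_mean_eq_bestMean (i : Fin N) : ∃ b, B.mean b = B.bestMean :=
  have : Nonempty (Fin N) := ⟨i⟩
  exists_eq_ciSup_of_finite

lemma gap_mem (i : Fin N) : B.gap i ∈ Set.Icc (0 : ℝ) 1 := by
  obtain ⟨b, hb⟩ := B.exists_mean_eq_bestMean i
  constructor
  · exact sub_nonneg.2 (le_ciSup (Set.finite_range B.mean).bddAbove i)
  · rw [gap, ← hb]
    linarith [(B.mean_mem b).2, (B.mean_mem i).1]

lemma sortedGap_succ (i : Fin N) : B.sortedGap (i + 1) = B.gap (Tuple.sort B.gap i) := by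
  rw [sortedGap, dif_pos ⟨by omega, i.2⟩]
  rfl

lemma sortedGap_mem (p : ℕ) : B.sortedGap p ∈ Set.Icc (0 : ℝ) 1 := by
  rw [sortedGap]
  split_ifs
  · exact B.gap_mem _
  · simp

lemma sortedGap_mono {p q : ℕ} (hp : 1 ≤ p) (hpq : p ≤ q) (hq : q ≤ N) :
    B.sortedGap p ≤ B.sortedGap q := by
  rw [sortedGap, sortedGap, dif_pos ⟨hp, by omega⟩, dif_pos ⟨by omega, hq⟩]
  exact Tuple.monotone_sort B.gap (Fin.mk_le_mk.2 (by omega))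

lemma exists_sortedGap_eq (j : Fin N) : ∃ p, 1 ≤ p ∧ p ≤ N ∧ B.sortedGap p = B.gap j :=
  ⟨(Tuple.sort B.gap).symm j + 1, by omega, by omega, by simp [sortedGap_succ]⟩

lemma sortedGap_one : B.sortedGap 1 = 0 := by
  by_cases hN : 1 ≤ N
  · obtain ⟨b, hb⟩ := B.exists_mean_eq_bestMean ⟨0, hN⟩
    obtain ⟨p, hp, hpN, hpb⟩ := B.exists_sortedGap_eq b
    have h := B.sortedGap_mono le_rfl hp hpN
    rw [hpb, gap, hb, sub_self] at h
    exact le_antisymm h (B.sortedGap_mem 1).1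
  · rw [sortedGap, dif_neg (by omega)]

lemma gap_le_sortedGap (j : Fin N) : B.gap j ≤ B.sortedGap N := by
  obtain ⟨p, hp, hpN, hpj⟩ := B.exists_sortedGap_eq j
  exact hpj ▸ B.sortedGap_mono hp hpN le_rfl

lemma sum_sortedGap : ∑ i ∈ Finset.Icc 2 N, B.sortedGap i = ∑ j, B.gap j := by
  rw [← Equiv.sum_comp (Tuple.sort B.gap) B.gap]
  simp_rw [← sortedGap_succ]
  rw [Fin.sum_univ_eq_sum_range (fun i => B.sortedGap (i + 1)) N]
  cases N with
  | zero => simp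
  | succ n =>
    rw [Finset.sum_range_succ', zero_add, B.sortedGap_one, add_zero]
    rw [Finset.range_eq_Ico, Finset.sum_Ico_add' (fun i => B.sortedGap (i + 1)) 0 n 1,
      Finset.sum_Ico_add' B.sortedGap (0 + 1) (n + 1) 1]
    rfl

end ExpertBandit

/-! ### Probability of a bad expert and regret of a single step -/

namespace IsDUCBRun

variable {Ω 𝒳 : Type*} [MeasurableSpace Ω] [MeasurableSpace 𝒳] {K N : ℕ}
  {B : ExpertBandit 𝒳 K N} {D : Division N} {P : Measure Ω} [IsProbabilityMeasure P]
  {k : ℕ → Ω → Fin N} {Z : ℕ → Ω → 𝒳 × Fin K × ℝ}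

/-- An expert whose gap is large compared with the widths is followed with small probability. -/
lemma measure_expert_le (hrun : IsDUCBRun B D P k Z) (hB : B.ChiSquareFinite) (j : Fin N)
    {t : ℕ} (ht : 64 ≤ t) (hlog : 512 * Real.log t ≤ t)
    (hgap : 4 * (B.sigmaMax * √(64 * Real.log (1 / delta t) / t)) ≤ B.gap j) :
    P.real (k (t + 1) ⁻¹' {j}) ≤ 4 / (t : ℝ) ^ 2 := by
  obtain ⟨b, hb⟩ := B.exists_mean_eq_bestMean j
  have hL := one_le_log_of_le ht
  have hl : 1 ≤ numGroups t := by
    have : (0 : ℝ) < numGroups t := by linarith [lt_numGroups_add_one t]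
    exact_mod_cast this
  have hm : 1 ≤ t / (2 * numGroups t) := by
    have hm := le_group_size_mul ht hlog
    refine Nat.one_le_iff_ne_zero.2 fun h => ?_
    rw [h] at hm
    norm_num at hm
  have hsize : ∀ ω, ∀ r < numGroups t, 1 ≤ D.size t (fun u => k u ω) r := fun ω r hr => by
    rw [D.size_eq_groupCount]
    exact hm.trans (D.le_groupCount _ hr)
  set S₁ : Set Ω := {ω | B.momEstimate D t (fun u => k u ω) (fun u => Z u ω) b <
    B.mean b - B.width D t (fun u => k u ω) b} with hS₁
  set S₂ : Set Ω := {ω | B.mean j + 3 * B.width D t (fun u => k u ω) j ≤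
    B.momEstimate D t (fun u => k u ω) (fun u => Z u ω) j} with hS₂
  have h₁ : P.real S₁ ≤ 2 / (t : ℝ) ^ 2 := hrun.measure_downward_le hB b ht hlog fun ω hω =>
    ExpertBandit.exists_groups_of_momEstimate_lt hB hl (hsize ω) hω
  have h₂ : P.real S₂ ≤ 2 / (t : ℝ) ^ 2 := hrun.measure_upward_le hB j ht hlog fun ω hω =>
    ExpertBandit.exists_groups_of_le_momEstimate hB hl (hsize ω) (by norm_num) hω
  have hsub : P (k (t + 1) ⁻¹' {j}) ≤ P (S₁ ∪ S₂) := by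
    refine measure_mono_ae ?_
    filter_upwards [hrun.choose t (by omega)] with ω hω hj
    have hj' : k (t + 1) ω = j := hj
    have hmax := hω hl (hsize ω) b
    rw [hj', ExpertBandit.ucb, ExpertBandit.ucb] at hmax
    have hw := ExpertBandit.width_le hB hl (hsize ω) j
    -- If the best expert `b` is not underestimated, its index is at least `μ*`, hence so is that of
    -- `j`. As the gap is at least four widths, the estimate of `j` alone exceeds its mean by three.
    by_cases h : ω ∈ S₁
    · exact Or.inl h
    · refine Or.inr ?_
      simp only [hS₁, Set.mem_ofPred_eq, not_lt] at h
      simp only [hS₂, Set.mem_ofPred_eq]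
      rw [ExpertBandit.gap] at hgap
      linarith
  calc P.real (k (t + 1) ⁻¹' {j}) ≤ P.real (S₁ ∪ S₂) :=
        ENNReal.toReal_mono (measure_ne_top _ _) hsub
    _ ≤ P.real S₁ + P.real S₂ := measureReal_union_le _ _
    _ ≤ 4 / (t : ℝ) ^ 2 := by
        have : (4 : ℝ) / (t : ℝ) ^ 2 = 2 / (t : ℝ) ^ 2 + 2 / (t : ℝ) ^ 2 := by ring
        linarith

lemma integral_gap (hrun : IsDUCBRun B D P k Z) (t : ℕ) :
    ∫ ω, B.gap (k t ω) ∂P = ∑ j, P.real (k t ⁻¹' {j}) * B.gap j := by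
  have hk := hrun.measurable_expert t
  have := Measure.isProbabilityMeasure_map (μ := P) hk.aemeasurable
  have hg : Measurable B.gap := Measurable.of_discrete
  rw [← integral_map (f := B.gap) hk.aemeasurable hg.aestronglyMeasurable,
    integral_fintype (Integrable.of_finite)]
  refine Finset.sum_congr rfl fun j _ => ?_
  rw [map_measureReal_apply hk (measurableSet_singleton j), smul_eq_mul]

lemma sum_measure_expert (hrun : IsDUCBRun B D P k Z) (t : ℕ) :
    ∑ j, P.real (k t ⁻¹' {j}) = 1 := by
  have hk := hrun.measurable_expert t
  have := Measure.isProbabilityMeasure_map (μ := P) hk.aemeasurable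
  have h := sum_measureReal_singleton (μ := P.map (k t)) Finset.univ
  simp only [Finset.coe_univ, probReal_univ] at h
  rw [← h]
  exact Finset.sum_congr rfl fun j _ =>
    (map_measureReal_apply hk (measurableSet_singleton j)).symm

lemma regret_eq (hrun : IsDUCBRun B D P k Z) (T : ℕ) :
    regret B P k T = ∑ t ∈ Finset.Icc 1 T, ∫ ω, B.gap (k t ω) ∂P := by
  have hg : Measurable B.gap := Measurable.of_discrete
  exact integral_finsetSum _ fun t _ => Integrable.of_mem_Icc 0 1
    (hg.comp (hrun.measurable_expert t)).aemeasurable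
    (Filter.Eventually.of_forall fun ω => B.gap_mem _)

/-- Experts in `p` share total probability at most 1, so they cost at most `a` together; the others
are charged individually. -/
lemma integral_gap_le_of_split (hrun : IsDUCBRun B D P k Z) (t : ℕ) {p : Fin N → Prop}
    {a q : ℝ} (ha : 0 ≤ a) (hq : 0 ≤ q) (h1 : ∀ j, p j → B.gap j ≤ a)
    (h2 : ∀ j, ¬ p j → P.real (k t ⁻¹' {j}) ≤ q) :
    ∫ ω, B.gap (k t ω) ∂P ≤ a + q * ∑ j, B.gap j := by
  rw [hrun.integral_gap, ← mul_one a, ← hrun.sum_measure_expert t, Finset.mul_sum, Finset.mul_sum,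
    ← Finset.sum_add_distrib]
  refine Finset.sum_le_sum fun j _ => ?_
  have hg := (B.gap_mem j).1
  have hP : 0 ≤ P.real (k t ⁻¹' {j}) := measureReal_nonneg
  by_cases hj : p j
  · nlinarith [h1 j hj, mul_nonneg hq hg]
  · nlinarith [h2 j hj, mul_nonneg ha hP]

end IsDUCBRun

/-! ### Layers of gaps and elementary sums -/

/-- Summation by parts for the layers of a monotone sequence of gaps. -/
lemma sum_layers_eq (g : ℕ → ℝ) (M : ℝ) (h1 : g 1 = 0) {n : ℕ} (hn : 1 ≤ n)
    (h0 : ∀ i, 0 ≤ g i) (hmono : ∀ i, 1 ≤ i → i + 1 ≤ n → g i ≤ g (i + 1)) :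
    ∑ i ∈ Finset.Icc 2 n, (g i - g (i - 1)) * (M / g i ^ 2) =
      M / g n + ∑ i ∈ Finset.Icc 2 (n - 1), M / g i * (1 - g i ^ 2 / g (i + 1) ^ 2) := by
  induction n, hn using Nat.le_induction with
  | base => simp [h1]
  | succ n hn ih =>
    have hsum : ∑ i ∈ Finset.Icc 2 n, M / g i * (1 - g i ^ 2 / g (i + 1) ^ 2) =
        ∑ i ∈ Finset.Icc 2 (n - 1), M / g i * (1 - g i ^ 2 / g (i + 1) ^ 2) +
          M / g n * (1 - g n ^ 2 / g (n + 1) ^ 2) := by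
      rcases Nat.lt_or_ge n 2 with h | h
      · obtain rfl : n = 1 := by omega
        simp [h1]
      · obtain ⟨m, rfl⟩ : ∃ m, n = m + 1 := ⟨n - 1, by omega⟩
        rw [Finset.sum_Icc_succ_top h, Nat.add_sub_cancel]
    rw [Finset.sum_Icc_succ_top (by omega), ih fun i hi hin => hmono i hi (by omega),
      Nat.add_sub_cancel, hsum]
    -- Vanishing gaps are treated separately: division by 0 gives 0, and monotonicity makes `g n`
    -- vanish with `g (n + 1)`.
    have hle := hmono n hn le_rfl
    rcases eq_or_ne (g (n + 1)) 0 with hz | hz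
    · have : g n = 0 := le_antisymm (hz ▸ hle) (h0 n)
      simp [hz, this]
    · rcases eq_or_ne (g n) 0 with hz' | hz'
      · simp only [hz']
        field_simp
        ring
      · field_simp
        ring

/-- The gap of any expert is the sum of the layers below it. -/
lemma le_sum_layers (g : ℕ → ℝ) {p n : ℕ} (h1 : g 1 = 0) (hp : 1 ≤ p) (hpn : p ≤ n)
    (hmono : ∀ i, 1 ≤ i → i + 1 ≤ n → g i ≤ g (i + 1)) (c : ℕ → Prop) [DecidablePred c]
    (hc : ∀ i ∈ Finset.Icc 2 p, g i ≠ g (i - 1) → c i) :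
    g p ≤ ∑ i ∈ Finset.Icc 2 n, if c i then g i - g (i - 1) else 0 := by
  have htel : ∀ q, 1 ≤ q → ∑ i ∈ Finset.Icc 2 q, (g i - g (i - 1)) = g q := by
    intro q hq
    induction q, hq using Nat.le_induction with
    | base => simp [h1]
    | succ q hq ih =>
      rw [Finset.sum_Icc_succ_top (by omega), ih]
      simp
  calc g p = ∑ i ∈ Finset.Icc 2 p, if c i then g i - g (i - 1) else 0 := by
        rw [← htel p hp]
        refine Finset.sum_congr rfl fun i hi => ?_
        split_ifs with hci
        · rfl
        · have : g i = g (i - 1) := by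
            by_contra hne
            exact hci (hc i hi hne)
          rw [this, sub_self]
    _ ≤ _ := by
        refine Finset.sum_le_sum_of_subset_of_nonneg (Finset.Icc_subset_Icc_right hpn)
          fun i hi _ => ?_
        have hi' := Finset.mem_Icc.1 hi
        split_ifs
        · have := hmono (i - 1) (by omega) (by omega)
          rw [Nat.sub_add_cancel (by omega)] at this
          linarith
        · exact le_rfl

lemma card_filter_lt_le {τ : ℝ} (hτ : 0 ≤ τ) (n : ℕ) :
    (((Finset.Icc 1 n).filter fun s : ℕ => (s : ℝ) < τ).card : ℝ) ≤ τ := by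
  have hsub : ((Finset.Icc 1 n).filter fun s : ℕ => (s : ℝ) < τ) ⊆ Finset.Icc 1 ⌊τ⌋₊ := by
    intro s hs
    simp only [Finset.mem_filter, Finset.mem_Icc] at hs ⊢
    exact ⟨hs.1.1, Nat.le_floor hs.2.le⟩
  have := Finset.card_le_card hsub
  rw [Nat.card_Icc, Nat.add_sub_cancel] at this
  exact (Nat.cast_le.2 this).trans (Nat.floor_le hτ)

lemma sum_tail_inv_sq_le {s₀ : ℕ} (hs₀ : 8 ≤ s₀) (n : ℕ) :
    ∑ s ∈ Finset.Icc 1 n, (if s₀ ≤ s then 4 / (s : ℝ) ^ 2 else 0) ≤ 1 := by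
  rw [← Finset.sum_filter]
  have hset : ((Finset.Icc 1 n).filter fun s => s₀ ≤ s) = Finset.Ioo (s₀ - 1) (n + 1) := by
    ext s
    simp only [Finset.mem_filter, Finset.mem_Icc, Finset.mem_Ioo]
    omega
  have h := sum_Ioo_inv_sq_le (α := ℝ) (s₀ - 1) (n + 1)
  have hcast : ((s₀ - 1 : ℕ) : ℝ) + 1 = s₀ := by
    rw [Nat.cast_sub (by omega)]
    simp
  have h8 : (8 : ℝ) ≤ s₀ := by exact_mod_cast hs₀
  rw [hset]
  simp_rw [div_eq_mul_inv]
  rw [← Finset.mul_sum]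
  rw [hcast] at h
  have : 2 / (s₀ : ℝ) ≤ 1 / 4 := by
    rw [div_le_div_iff₀ (by linarith) (by norm_num)]
    linarith
  linarith

lemma exists_log_threshold : ∃ s₀ : ℕ, 64 ≤ s₀ ∧ ∀ t : ℕ, s₀ ≤ t → 512 * Real.log t ≤ t := by
  have h := (Real.isLittleO_log_id_atTop.bound (show (0 : ℝ) < 1 / 512 by norm_num))
  obtain ⟨s, hs⟩ := Filter.eventually_atTop.1 (tendsto_natCast_atTop_atTop.eventually h)
  refine ⟨max s 64, le_max_right _ _, fun t ht => ?_⟩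
  have h1 := hs t ((le_max_left _ _).trans ht)
  simp only [id, Real.norm_eq_abs, Nat.abs_cast] at h1
  linarith [le_abs_self (Real.log t)]

/-! ### Assembly of the regret bound -/

theorem theorem2 : ∃ C₂ : ℝ, 0 < C₂ ∧
    ∀ (𝒳 Ω : Type*) [MeasurableSpace 𝒳] [MeasurableSpace Ω] (K N : ℕ)
      (B : ExpertBandit 𝒳 K N) (D : Division N)
      (P : Measure Ω) [IsProbabilityMeasure P]
      (k : ℕ → Ω → Fin N) (Z : ℕ → Ω → 𝒳 × Fin K × ℝ),
      B.ChiSquareFinite → IsDUCBRun B D P k Z →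
      ∀ T : ℕ, 1 ≤ T →
        regret B P k T ≤
          C₂ * B.sigmaMax ^ 2 * Real.log T / B.sortedGap N +
          ∑ i ∈ Finset.Icc 2 (N - 1),
            C₂ * B.sigmaMax ^ 2 * Real.log T / B.sortedGap i *
              (1 - B.sortedGap i ^ 2 / B.sortedGap (i + 1) ^ 2) +
          Real.pi ^ 2 / 3 * ∑ i ∈ Finset.Icc 2 N, B.sortedGap i := by
  obtain ⟨s₀, hs₀, hlog⟩ := exists_log_threshold
  -- 2048 = 4² · 64 · 2 comes from four widths with `log (1/δ(s)) = 2 log s`; `2 * s₀` pays for the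
  -- steps before the estimates apply.
  refine ⟨2048 + 2 * s₀, by positivity, ?_⟩
  intro 𝒳 Ω _ _ K N B D P _ k Z hB hrun T hT
  obtain ⟨ω₀⟩ : Nonempty Ω := P.nonempty_of_neZero
  have hN : 1 ≤ N := (Nat.zero_le _).trans_lt (k 0 ω₀).2
  set g := B.sortedGap with hg
  set L := Real.log T with hL
  set σ := B.sigmaMax with hσ
  have hL0 : 0 ≤ L := Real.log_natCast_nonneg T
  have hσ1 : 1 ≤ σ := (B.one_le_sigma hB (k 0 ω₀) (k 0 ω₀)).trans (B.sigma_le_sigmaMax _ _)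
  have hg0 : ∀ i, 0 ≤ g i := fun i => (B.sortedGap_mem i).1
  have hmono : ∀ i, 1 ≤ i → i + 1 ≤ N → g i ≤ g (i + 1) := fun i hi hiN =>
    B.sortedGap_mono hi (by omega) hiN
  set G := ∑ j, B.gap j with hG
  have hGnonneg : 0 ≤ G := Finset.sum_nonneg fun j _ => (B.gap_mem j).1
  set τ : ℕ → ℝ := fun i => 2048 * σ ^ 2 * L / g i ^ 2 with hτ
  have hτ0 : ∀ i, 0 ≤ τ i := fun i => by positivity
  -- The layers still unpaid at time `s`: an upper bound for the gap of every expert not yet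
  -- excluded.
  set m : ℕ → ℝ := fun s =>
    ∑ i ∈ Finset.Icc 2 N, if (s : ℝ) < τ i then g i - g (i - 1) else 0 with hm
  have hm0 : ∀ s, 0 ≤ m s := fun s => by
    have := le_sum_layers g B.sortedGap_one le_rfl hN hmono (fun i => (s : ℝ) < τ i) (by simp)
    exact B.sortedGap_one.ge.trans this
  -- the regret of a single time step
  have hstep : ∀ s ∈ Finset.Icc 1 (T - 1), ∫ ω, B.gap (k (s + 1) ω) ∂P ≤
      (if s < s₀ then g N else 0) + m s + (if s₀ ≤ s then 4 / (s : ℝ) ^ 2 else 0) * G := by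
    intro s hs
    have hs1 := (Finset.mem_Icc.1 hs).1
    have hsT : s ≤ T := by have := (Finset.mem_Icc.1 hs).2; omega
    rcases Nat.lt_or_ge s s₀ with h | h
    · rw [if_pos h, if_neg (by omega), zero_mul, add_zero]
      have := hrun.integral_gap_le_of_split (s + 1) (p := fun _ => True) (hg0 N) le_rfl
        (fun j _ => B.gap_le_sortedGap j) (fun j hj => absurd trivial hj)
      linarith [hm0 s]
    · rw [if_neg (by omega), if_pos h, zero_add]
      refine hrun.integral_gap_le_of_split (s + 1)
        (p := fun j => B.gap j < 4 * (σ * √(64 * Real.log (1 / delta s) / s)))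
        (hm0 s) (by positivity) (fun j hj => ?_) fun j hj =>
          hrun.measure_expert_le hB j (hs₀.trans h) (hlog s h) (not_lt.1 hj)
      obtain ⟨p, hp, hpN, hpj⟩ := B.exists_sortedGap_eq j
      rw [← hpj] at hj ⊢
      have hspos : (0 : ℝ) < s := by exact_mod_cast hs1
      have hlogs : Real.log s ≤ L := Real.log_le_log hspos (by exact_mod_cast hsT)
      have hlogs0 : 0 ≤ Real.log s := Real.log_natCast_nonneg s
      refine le_sum_layers g B.sortedGap_one hp hpN hmono _ fun i hi hne => ?_
      have hi' := Finset.mem_Icc.1 hi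
      have hile : g i ≤ g p := B.sortedGap_mono (by omega) hi'.2 hpN
      -- A layer at gap 0 has `τ i = 0` by division by 0 and is never active; it is also empty, so
      -- only positive `g i` matter.
      have hipos : 0 < g i := by
        refine lt_of_le_of_ne (hg0 i) fun h0 => hne ?_
        have h3 := hmono (i - 1) (by omega) (by omega)
        rw [Nat.sub_add_cancel (by omega)] at h3
        exact le_antisymm (h0 ▸ hg0 _) h3
      have hsq : g i ^ 2 < (4 * (σ * √(64 * Real.log (1 / delta s) / s))) ^ 2 :=
        pow_lt_pow_left₀ (hile.trans_lt hj) hipos.le (by norm_num)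
      rw [log_one_div_delta, mul_pow, mul_pow, Real.sq_sqrt (by positivity)] at hsq
      simp only [hτ]
      rw [lt_div_iff₀ (by positivity)]
      calc (s : ℝ) * g i ^ 2 < s * (4 ^ 2 * (σ ^ 2 * (64 * (2 * Real.log s) / s))) :=
            mul_lt_mul_of_pos_left hsq hspos
        _ = 2048 * σ ^ 2 * Real.log s := by field_simp; ring
        _ ≤ 2048 * σ ^ 2 * L := by gcongr
  -- The first step cannot be charged to the logarithmic terms, which vanish for `T = 1`.
  have hfirst : ∫ ω, B.gap (k 1 ω) ∂P ≤ G := by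
    rw [hrun.integral_gap]
    exact Finset.sum_le_sum fun j _ =>
      mul_le_of_le_one_left (B.gap_mem j).1 measureReal_le_one
  have hregret : regret B P k T =
      ∫ ω, B.gap (k 1 ω) ∂P + ∑ s ∈ Finset.Icc 1 (T - 1), ∫ ω, B.gap (k (s + 1) ω) ∂P := by
    rw [hrun.regret_eq]
    obtain ⟨n, rfl⟩ : ∃ n, T = n + 1 := ⟨T - 1, by omega⟩
    rw [← Finset.add_sum_Ioc_eq_sum_Icc hT, Nat.add_sub_cancel]
    congr 1
    exact (Finset.sum_Ico_add' (fun s => ∫ ω, B.gap (k s ω) ∂P) 1 (n + 1) 1).symm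
  -- the three sums
  have hsmall : ∑ s ∈ Finset.Icc 1 (T - 1), (if s < s₀ then g N else 0) ≤
      2 * s₀ * L * g N := by
    rcases eq_or_lt_of_le hT with h | h
    · rw [← h]
      simp only [Nat.sub_self, Finset.Icc_eq_empty_of_lt Nat.zero_lt_one,
        Finset.sum_empty]
      have := hg0 N
      positivity
    · have hL2 : 1 / 2 ≤ L := by
        have h2 : Real.log 2 ≤ L := Real.log_le_log (by norm_num) (by exact_mod_cast h)
        linarith [Real.log_two_gt_d9]
      rw [← Finset.sum_filter, Finset.sum_const, nsmul_eq_mul]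
      refine mul_le_mul_of_nonneg_right ?_ (hg0 N)
      have hcard : ((Finset.Icc 1 (T - 1)).filter fun s => s < s₀).card ≤ s₀ := by
        have := Finset.card_le_card (show ((Finset.Icc 1 (T - 1)).filter fun s => s < s₀) ⊆
          Finset.range s₀ from fun s hs => Finset.mem_range.2 (Finset.mem_filter.1 hs).2)
        simpa using this
      have hcard' : (((Finset.Icc 1 (T - 1)).filter fun s => s < s₀).card : ℝ) ≤ s₀ := by
        exact_mod_cast hcard
      nlinarith [Nat.cast_nonneg (α := ℝ) s₀]
  have hlayers : ∑ s ∈ Finset.Icc 1 (T - 1), m s ≤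
      2048 * σ ^ 2 * L / g N + ∑ i ∈ Finset.Icc 2 (N - 1),
        2048 * σ ^ 2 * L / g i * (1 - g i ^ 2 / g (i + 1) ^ 2) := by
    rw [← sum_layers_eq g (2048 * σ ^ 2 * L) B.sortedGap_one hN hg0 hmono]
    simp only [hm]
    rw [Finset.sum_comm]
    refine Finset.sum_le_sum fun i hi => ?_
    have hi' := Finset.mem_Icc.1 hi
    rw [← Finset.sum_filter, Finset.sum_const, nsmul_eq_mul, mul_comm]
    refine mul_le_mul_of_nonneg_left (card_filter_lt_le (hτ0 i) _) ?_
    have h3 := hmono (i - 1) (by omega) (by omega)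
    rw [Nat.sub_add_cancel (by omega)] at h3
    linarith
  have htail := mul_le_mul_of_nonneg_right (sum_tail_inv_sq_le (s₀ := s₀) (by omega) (T - 1))
    hGnonneg
  have hsum := Finset.sum_le_sum hstep
  rw [Finset.sum_add_distrib, Finset.sum_add_distrib, ← Finset.sum_mul] at hsum
  -- comparison with the claimed bound
  set Q := ∑ i ∈ Finset.Icc 2 (N - 1), 1 / g i * (1 - g i ^ 2 / g (i + 1) ^ 2) with hQ
  have hQ0 : 0 ≤ Q := Finset.sum_nonneg fun i hi => by
    have hi' := Finset.mem_Icc.1 hi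
    refine mul_nonneg (one_div_nonneg.2 (hg0 i)) (sub_nonneg.2 (div_le_one_of_le₀ ?_ (sq_nonneg _)))
    exact pow_le_pow_left₀ (hg0 i) (hmono i (by omega) (by omega)) 2
  have hscale : ∀ c : ℝ, c * σ ^ 2 * L / g N + ∑ i ∈ Finset.Icc 2 (N - 1),
      c * σ ^ 2 * L / g i * (1 - g i ^ 2 / g (i + 1) ^ 2) = c * (σ ^ 2 * L * (1 / g N + Q)) := by
    intro c
    rw [hQ, mul_add, mul_add, Finset.mul_sum, Finset.mul_sum]
    congr 1
    · ring
    · exact Finset.sum_congr rfl fun i _ => by ring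
  -- Gaps are at most 1; if the largest gap is 0, both sides are 0.
  have hgN : g N ≤ 1 / g N := by
    rcases (hg0 N).eq_or_lt with h | h
    · rw [← h]
      simp
    · have hle := (B.sortedGap_mem N).2
      rw [le_div_iff₀ h]
      nlinarith
  have hconst : L * g N ≤ σ ^ 2 * L * (1 / g N + Q) := by
    have h1 : 1 ≤ σ ^ 2 := one_le_pow₀ hσ1
    calc L * g N ≤ (σ ^ 2 * L) * g N :=
          mul_le_mul_of_nonneg_right (le_mul_of_one_le_left hL0 h1) (hg0 N)
      _ ≤ _ := mul_le_mul_of_nonneg_left (by linarith) (by positivity)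
  have hconst' := mul_le_mul_of_nonneg_left hconst (show (0 : ℝ) ≤ 2 * s₀ by positivity)
  rw [hscale] at hlayers ⊢
  rw [B.sum_sortedGap, ← hG, hregret]
  -- One `G` is for the first step, the other for the sum of the tails 4/s².
  have hpi : 2 * G ≤ Real.pi ^ 2 / 3 * G :=
    mul_le_mul_of_nonneg_right (by nlinarith [Real.pi_gt_three]) hGnonneg
  linarith
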